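/- Let $\mathbb{R}^+=[0,\infty)$, let $\gamma:\mathbb{R}^+\to(0,1)$ be continuous, and let $\beta:\mathbb{R}^+\to[0,\infty)$ be a probability density with respect to Lebesgue measure (with arbitrary support; in particular the support may be $(0,a)$ with $0<a\le\infty$). Let $\{X_n\}_{n\ge0}$ be the Markov chain on $\mathbb{R}^+$ with one-step transition kernel $$P(x,dy)=\begin{cases}\beta(y)\,dy,&x=0,\\ \gamma(x)\,\delta_{0}(dy)+(1-\gamma(x))\,\delta_{x+1}(dy),&x>0,\end{cases}$$ write $\mathbb{P}_x,\mathbb{E}_x$ for the chain started at $x$, and $\tau_A^+=\inf\{n\ge1:X_n\in A\}$. Definitions. A nontrivial $\sigma$-finite measure $\varphi$ is an irreducibility measure if $\varphi(A)>0$ implies $\sum_{n\ge1}P^n(x,A)>0$ for all $x$; it is maximal if it dominates (in the sense of absolute continuity) every irreducibility measure. Given a maximal irreducibility measure $\psi$, let $\mathscr{B}^+$ be the family of Borel sets $A$ with $\psi(A)>0$. A Borel set $C$ is petite if there are a probability distribution $(a_n)$ on $\mathbb{Z}_+$ and a nontrivial measure $\nu$ with $\sum_{n\ge0}a_nP^n(x,B)\ge\nu(B)$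 for all $x\in C$ and all Borel $B$. The chain is * recurrent if $\sum_{n\ge1}P^n(x,A)=\infty$ for all $x$ and all $A\in\mathscr{B}^+$, and transient otherwise; * Harris recurrent if $\mathbb{P}_x(\sum_{n\ge1}\mathbf 1_{\{X_n\in A\}}=\infty)=1$ for all $x$ and all $A\in\mathscr{B}^+$; * ergodic if it is Harris recurrent and some petite $C\in\mathscr{B}^+$ satisfies $\sup_{x\in C}\mathbb{E}_x\tau_C^+<\infty$; * geometrically ergodic if some nonempty petite $C$ and some $r>1$ satisfy $\sup_{x\in C}\mathbb{E}_x r^{\tau_C^+}<\infty$; * strongly ergodic if some petite $C$ satisfies $\sup_{x\in\mathbb{R}^+}\mathbb{E}_x\tau_C^+<\infty$. Then the chain has a maximal irreducibility measure, and with respect to any such measure the following hold. 1. The chain is Harris recurrent, and recurrent, if there is $x_1>0$ with $$\prod_{k=\lfloor x_1\rfloor}^{\infty}\ \sup_{k\le x<k+1}(1-\gamma(x))=0.$$ It is transient if there is $x_1>0$ with $$\prod_{k=\lfloor x_1\rfloor}^{\infty}\ \inf_{k\le x<k+1}(1-\gamma(x))>0.$$ 2. The chain is not ergodic if there is $x_1>0$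 with $$\int_{x_1}^{\infty}\frac{\beta(x)}{\sup_{y\ge x}\gamma(y)}\,dx=\infty.$$ It is ergodic if there is $x_1>0$ with $$\sup_{x>x_1}\left(\frac1{\gamma(x+1)}-\frac1{\gamma(x)}\right)<1\quad\text{and}\quad\int_{x_1}^{\infty}\frac{\beta(y)}{\gamma(y)}\,dy<\infty.$$ 3. If $\limsup_{x\to\infty}\gamma(x)=0$, the chain is neither geometrically ergodic nor strongly ergodic. 4. If $\liminf_{x\to\infty}\gamma(x)>0$, the chain is strongly ergodic. -/

import Mathlib

open MeasureTheory ProbabilityTheory Filter Topology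
open scoped NNReal ENNReal

noncomputable section

namespace MarkovChain

variable {X : Type*} [MeasurableSpace X]

/-- The law `ℙ_x` on path space `ℕ → X` of the homogeneous Markov chain with one-step transition
kernel `P` started at `X_0 = x` (Ionescu-Tulcea): given the path up to time `n`, the position at
time `n + 1` has law `P (ω n)`. -/
def pathLaw (P : Kernel X X) [IsMarkovKernel P] (x : X) : Measure (ℕ → X) :=
  Kernel.traj (X := fun _ : ℕ => X)
    (fun n => P.comap (fun h : (i : Finset.Iic n) → X => h ⟨n, Finset.mem_Iic.2 le_rfl⟩)
      (measurable_pi_apply _)) 0 (fun _ => x)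

/-- The first return time `τ_A^+ = inf {n ≥ 1 : X_n ∈ A}` (`⊤` if `A` is never visited after
time `0`). -/
def returnTime (A : Set X) (ω : ℕ → X) : ℕ∞ :=
  ⨅ (n : ℕ) (_ : 1 ≤ n ∧ ω n ∈ A), (n : ℕ∞)

/-- `𝔼_x τ_A^+`. -/
def meanReturnTime (P : Kernel X X) [IsMarkovKernel P] (A : Set X) (x : X) : ℝ≥0∞ :=
  ∫⁻ ω, (returnTime A ω : ℝ≥0∞) ∂(pathLaw P x)

/-- `r ^ t` for a time `t ∈ ℕ ∪ {∞}` and a base `r > 1`, with `r ^ ∞ = ∞`. -/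
def powTime (r : ℝ≥0) (t : ℕ∞) : ℝ≥0∞ :=
  if t = ⊤ then ∞ else (r : ℝ≥0∞) ^ t.toNat

/-- `𝔼_x r ^ (τ_A^+)`, for `r > 1`. -/
def geomMoment (P : Kernel X X) [IsMarkovKernel P] (r : ℝ≥0) (A : Set X) (x : X) : ℝ≥0∞ :=
  ∫⁻ ω, powTime r (returnTime A ω) ∂(pathLaw P x)

/-- `φ` is an irreducibility measure for `P`: a nontrivial `σ`-finite measure such that every
set of positive `φ`-measure is reached from every point in some number `n ≥ 1` of steps with
positive probability. -/
structure IsIrreducibilityMeasure (P : Kernel X X) (φ : Measure X) : Prop where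
  sigmaFinite : SigmaFinite φ
  ne_zero : φ ≠ 0
  pos : ∀ A : Set X, MeasurableSet A → 0 < φ A → ∀ x, 0 < ∑' n : ℕ, (P ^ (n + 1)) x A

/-- `ψ` is a maximal irreducibility measure: it dominates all irreducibility measures. -/
structure IsMaximalIrreducibilityMeasure (P : Kernel X X) (ψ : Measure X) : Prop where
  irreducible : IsIrreducibilityMeasure P ψ
  maximal : ∀ φ : Measure X, IsIrreducibilityMeasure P φ → φ ≪ ψ

/-- `C` is petite: there are a probability distribution `a` on `ℕ` and a nontrivial measure `ν`
with `∑ a_n P^n(x, ·) ≥ ν` for all `x ∈ C`. -/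
def IsPetite (P : Kernel X X) (C : Set X) : Prop :=
  MeasurableSet C ∧ ∃ (a : PMF ℕ) (ν : Measure X), ν ≠ 0 ∧
    ∀ x ∈ C, ∀ B : Set X, MeasurableSet B → ν B ≤ ∑' n : ℕ, a n * (P ^ n) x B

/-- Recurrence: `∑_{n ≥ 1} P^n(x, A) = ∞` for all `x` and all measurable `A` with `ψ A > 0`. -/
def IsRecurrent (P : Kernel X X) (ψ : Measure X) : Prop :=
  ∀ x, ∀ A : Set X, MeasurableSet A → 0 < ψ A → ∑' n : ℕ, (P ^ (n + 1)) x A = ∞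

/-- Transience: not recurrent. -/
def IsTransient (P : Kernel X X) (ψ : Measure X) : Prop :=
  ¬ IsRecurrent P ψ

/-- Harris recurrence: from every `x`, almost surely every given measurable `A` with `ψ A > 0` is
visited infinitely often. -/
def IsHarrisRecurrent (P : Kernel X X) [IsMarkovKernel P] (ψ : Measure X) : Prop :=
  ∀ x, ∀ A : Set X, MeasurableSet A → 0 < ψ A →
    ∀ᵐ ω ∂(pathLaw P x), ∑' n : ℕ, A.indicator (fun _ => (1 : ℝ≥0∞)) (ω (n + 1)) = ∞

/-- Ergodicity: Harris recurrence together with a petite set `C`, `ψ C > 0`, whose mean return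
times are bounded on `C`. -/
def IsErgodicChain (P : Kernel X X) [IsMarkovKernel P] (ψ : Measure X) : Prop :=
  IsHarrisRecurrent P ψ ∧
    ∃ C : Set X, IsPetite P C ∧ 0 < ψ C ∧ (⨆ x ∈ C, meanReturnTime P C x) < ∞

/-- Geometric ergodicity: some nonempty petite set has a geometric moment of its return time
bounded on itself. (The empty set is petite and would satisfy the bound vacuously.) -/
def IsGeometricallyErgodic (P : Kernel X X) [IsMarkovKernel P] : Prop :=
  ∃ C : Set X, IsPetite P C ∧ C.Nonempty ∧
    ∃ r : ℝ≥0, 1 < r ∧ (⨆ x ∈ C, geomMoment P r C x) < ∞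

/-- Strong (uniform) ergodicity: some petite set has mean return times bounded over the whole
state space. -/
def IsStronglyErgodic (P : Kernel X X) [IsMarkovKernel P] : Prop :=
  ∃ C : Set X, IsPetite P C ∧ (⨆ x, meanReturnTime P C x) < ∞

end MarkovChain

namespace JumpChain

/-- Lebesgue measure on `ℝ⁺ = [0, ∞)`. -/
def lebesgue : Measure ℝ≥0 := Measure.comap ((↑) : ℝ≥0 → ℝ) volume

/-- The transition probabilities: `P(0, dy) = β(y) dy` and, for `x > 0`,
`P(x, ·) = γ(x) δ_0 + (1 - γ(x)) δ_{x+1}`. -/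
def transition (γ : ℝ≥0 → ℝ) (β : ℝ≥0 → ℝ≥0) (x : ℝ≥0) : Measure ℝ≥0 :=
  if x = 0 then lebesgue.withDensity (fun y => (β y : ℝ≥0∞))
  else ENNReal.ofReal (γ x) • Measure.dirac 0 + ENNReal.ofReal (1 - γ x) • Measure.dirac (x + 1)

theorem measurable_transition {γ : ℝ≥0 → ℝ} (hγ : Continuous γ) (β : ℝ≥0 → ℝ≥0) :
    Measurable (transition γ β) := by
  refine Measurable.ite (measurableSet_singleton 0) measurable_const ?_
  refine Measure.measurable_of_measurable_coe _ fun s hs => ?_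
  simp only [Measure.add_apply, Measure.smul_apply, smul_eq_mul, Measure.dirac_apply' _ hs]
  have h1 : Measurable fun x : ℝ≥0 => s.indicator (1 : ℝ≥0 → ℝ≥0∞) (x + 1) :=
    (measurable_one.indicator hs).comp (measurable_id.add_const 1)
  have h2 := hγ.measurable
  fun_prop

/-- The transition kernel of the chain, as a Markov kernel on `[0, ∞)`. -/
def kernel (γ : ℝ≥0 → ℝ) (β : ℝ≥0 → ℝ≥0) (hγ : Continuous γ)
    (_hγ01 : ∀ x, 0 < γ x ∧ γ x < 1) (_hβ : ∫⁻ y, (β y : ℝ≥0∞) ∂lebesgue = 1) :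
    Kernel ℝ≥0 ℝ≥0 where
  toFun := transition γ β
  measurable' := measurable_transition hγ β

instance isMarkovKernel_kernel (γ : ℝ≥0 → ℝ) (β : ℝ≥0 → ℝ≥0) (hγ : Continuous γ)
    (hγ01 : ∀ x, 0 < γ x ∧ γ x < 1) (hβ : ∫⁻ y, (β y : ℝ≥0∞) ∂lebesgue = 1) :
    IsMarkovKernel (kernel γ β hγ hγ01 hβ) := by
  refine ⟨fun x => ⟨?_⟩⟩
  change transition γ β x Set.univ = 1
  unfold transition
  split_ifs
  · simpa using hβ
  · have h := hγ01 x
    simp only [Measure.add_apply, Measure.smul_apply, smul_eq_mul, measure_univ, mul_one]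
    rw [← ENNReal.ofReal_add h.1.le (by linarith [h.2])]
    simp

end JumpChain

end

/-! From `x > 0` the chain climbs through `x + 1`, `x + 2`, ... until it falls to `0`, so everything
is governed by `climb γ n x`, the probability of `n` upward jumps in a row, and by the position from
which an excursion starts. The state `0` is accessible from everywhere: averaging the laws `P^n(0,
·)` gives a maximal irreducibility measure, every maximal one charges `{0}`, and `{0}` is petite.

Recurrence and transience. If `climb γ n x` tends to `0`, the chance of avoiding `A` is largest when
starting from `0`; there it is at most itself times some `P^m(0, Aᶜ) < 1`, hence zero
(`isHarrisRecurrent_of_tendsto_climb`). If `climb γ n x` stays bounded below, each excursion escapes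
with positive probability, so the expected number of visits to `0` is finite
(`isTransient_of_le_climb`).

Negative results. When `γ` vanishes at infinity, petite sets are bounded (`bddAbove_of_isPetite`).
Above a bounded set the return time is at least a geometric time whose parameter is the tail
supremum of `γ`. This bounds its mean below (`inv_tailSup_le_meanReturnTime`), and climbing
probabilities that decay slower than any geometric rate make every exponential moment infinite
(`geomMoment_eq_top`).

Positive results. The functions `c / γ` and a constant are Lyapunov functions for the return time to
`0` (`meanReturnTime_zero_le_div`, `isStronglyErgodic_of_le`).

All of this uses one-step equations on path space, which come from the Markov property
`map_shift_pathLaw`. -/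

noncomputable section

namespace MarkovChain

variable {X : Type*} [MeasurableSpace X] (P : Kernel X X) [IsMarkovKernel P]

/-! ### The Markov property of `pathLaw` -/

/-- The conditional law of the position at time `n + 1` given the path up to time `n`. -/
def stepKernel (n : ℕ) : Kernel ((i : Finset.Iic n) → X) X :=
  P.comap (fun h => h ⟨n, Finset.mem_Iic.2 le_rfl⟩) (measurable_pi_apply _)

instance (n : ℕ) : IsMarkovKernel (stepKernel P n) := by
  unfold stepKernel; infer_instance

/-- `pathLaw` as a Markov kernel from the state space to the path space. -/
def pathKernel : Kernel X (ℕ → X) :=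
  (Kernel.traj (X := fun _ : ℕ => X) (stepKernel P) 0).comap (fun x _ => x)
    (measurable_pi_lambda _ fun _ => measurable_id)

instance : IsMarkovKernel (pathKernel P) := by
  unfold pathKernel; infer_instance

theorem pathLaw_eq_traj (x : X) :
    pathLaw P x = Kernel.traj (X := fun _ : ℕ => X) (stepKernel P) 0 (fun _ => x) := rfl

theorem pathKernel_apply (x : X) : pathKernel P x = pathLaw P x := rfl

instance (x : X) : IsProbabilityMeasure (pathLaw P x) := by
  rw [← pathKernel_apply]; infer_instance

theorem measurable_pathLaw : Measurable (pathLaw P) := (pathKernel P).measurable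

/-- Conditioning on the path up to time `n` in the law of the first `n + 2` positions. -/
theorem lintegral_pathLaw_last_step (x : X) (n : ℕ) {F : ((i : Finset.Iic n) → X) → ℝ≥0∞}
    (hF : Measurable F) {g : X → ℝ≥0∞} (hg : Measurable g) :
    ∫⁻ ω, F (Preorder.frestrictLe n ω) * g (ω (n + 1)) ∂(pathLaw P x) =
      ∫⁻ ω, F (Preorder.frestrictLe n ω) * ∫⁻ y, g y ∂(P (ω n)) ∂(pathLaw P x) := by
  have key := Kernel.partialTraj_compProd_eq_map_traj (X := fun _ : ℕ => X) (κ := stepKernel P)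
    (Nat.zero_le n) (x₀ := fun _ => x)
  have hm : Measurable fun p : ((i : Finset.Iic n) → X) × X => F p.1 * g p.2 := by fun_prop
  have hm2 : Measurable fun a : (i : Finset.Iic n) → X =>
      ∫⁻ b, F a * g b ∂(stepKernel P n a) := hm.lintegral_kernel_prod_right
  have hr := Preorder.measurable_frestrictLe (X := fun _ : ℕ => X) n
  rw [pathLaw_eq_traj]
  calc _ = ∫⁻ p, F p.1 * g p.2 ∂((Kernel.traj (X := fun _ : ℕ => X) (stepKernel P) 0
          fun _ => x).map fun ω => (Preorder.frestrictLe n ω, ω (n + 1))) :=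
        (lintegral_map hm (hr.prodMk (measurable_pi_apply (n + 1)))).symm
    _ = ∫⁻ a, ∫⁻ b, F a * g b ∂(stepKernel P n a) ∂((Kernel.traj (X := fun _ : ℕ => X)
          (stepKernel P) 0 fun _ => x).map (Preorder.frestrictLe n)) := by
        rw [← key, Measure.lintegral_compProd hm, Kernel.traj_map_frestrictLe_apply]
    _ = _ := by
        rw [lintegral_map hm2 hr]
        exact lintegral_congr fun ω => lintegral_const_mul _ hg

theorem lintegral_pathLaw_zero (x : X) {g : X → ℝ≥0∞} (hg : Measurable g) :
    ∫⁻ ω, g (ω 0) ∂(pathLaw P x) = g x := by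
  unfold pathLaw
  rw [Kernel.lintegral_traj _ (by fun_prop)]
  simp [Function.updateFinset]

theorem lintegral_prod_pathLaw_last_step (x : X) (n : ℕ) {f : ℕ → X → ℝ≥0∞}
    (hf : ∀ i, Measurable (f i)) :
    ∫⁻ ω, ∏ i ∈ Finset.range (n + 2), f i (ω i) ∂(pathLaw P x) =
      ∫⁻ ω, (∏ i ∈ Finset.range (n + 1), f i (ω i)) * ∫⁻ y, f (n + 1) y ∂(P (ω n))
        ∂(pathLaw P x) := by
  have h := lintegral_pathLaw_last_step P x n
    (F := fun h => ∏ i : Finset.Iic n, f i (h i)) (by fun_prop) (hf (n + 1))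
  have e : ∀ ω : ℕ → X, ∏ i : Finset.Iic n, f i (Preorder.frestrictLe n ω i) =
      ∏ i ∈ Finset.range (n + 1), f i (ω i) := fun ω => by
    rw [Nat.range_succ_eq_Iic]
    exact Finset.prod_coe_sort (Finset.Iic n) fun i => f i (ω i)
  simp only [e] at h
  simp only [Finset.prod_range_succ _ (n + 1)]
  exact h

/-- The path law is built by appending positions at the end, whereas the Markov property removes one
at the start. Induction on the length bridges the two: the last factor is integrated out and
absorbed into the one before it. -/
theorem lintegral_prod_pathLaw_first_step (n : ℕ) (x : X) (f : ℕ → X → ℝ≥0∞)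
    (hf : ∀ i, Measurable (f i)) :
    ∫⁻ ω, ∏ i ∈ Finset.range (n + 2), f i (ω i) ∂(pathLaw P x) =
      f 0 x * ∫⁻ y, ∫⁻ ω, ∏ i ∈ Finset.range (n + 1), f (i + 1) (ω i) ∂(pathLaw P y) ∂(P x) := by
  induction n generalizing f with
  | zero =>
    have hm : Measurable fun z => f 0 z * ∫⁻ y, f 1 y ∂(P z) :=
      (hf 0).mul (hf 1).lintegral_kernel
    rw [lintegral_prod_pathLaw_last_step P x 0 hf]
    simp only [zero_add, Finset.prod_range_one]
    rw [lintegral_pathLaw_zero P x hm]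
    simp_rw [lintegral_pathLaw_zero P _ (hf 1)]
  | succ n ih =>
    have hP : Measurable fun z => ∫⁻ y, f (n + 2) y ∂(P z) := (hf _).lintegral_kernel
    -- The shorter product, with the last factor averaged by `P` and merged into factor `n + 1`.
    let f' : ℕ → X → ℝ≥0∞ := Function.update f (n + 1)
      (fun z => f (n + 1) z * ∫⁻ y, f (n + 2) y ∂(P z))
    have hf' : ∀ i, Measurable (f' i) := fun i => by
      by_cases h : i = n + 1
      · subst h; simpa [f'] using! (hf _).mul hP
      · simpa [f', h] using hf i
    have e1 : ∀ ω : ℕ → X, (∏ i ∈ Finset.range (n + 2), f i (ω i)) *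
        ∫⁻ y, f (n + 2) y ∂(P (ω (n + 1))) = ∏ i ∈ Finset.range (n + 2), f' i (ω i) := fun ω => by
      rw [Finset.prod_range_succ, Finset.prod_range_succ _ (n + 1), mul_assoc]
      congr 1
      · refine Finset.prod_congr rfl fun i hi => ?_
        have : i ≠ n + 1 := by have := Finset.mem_range.1 hi; omega
        simp [f', this]
      · simp [f']
    have e2 : ∀ ω : ℕ → X, (∏ i ∈ Finset.range (n + 1), f (i + 1) (ω i)) *
        ∫⁻ y, f (n + 2) y ∂(P (ω n)) = ∏ i ∈ Finset.range (n + 1), f' (i + 1) (ω i) := fun ω => by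
      rw [Finset.prod_range_succ, Finset.prod_range_succ _ n, mul_assoc]
      congr 1
      · refine Finset.prod_congr rfl fun i hi => ?_
        have : i ≠ n := by have := Finset.mem_range.1 hi; omega
        simp [f', this]
      · simp [f']
    rw [lintegral_prod_pathLaw_last_step P x (n + 1) hf]
    simp_rw [e1]
    rw [ih f' hf']
    congr 1
    refine lintegral_congr fun y => ?_
    rw [lintegral_prod_pathLaw_last_step P y n (f := fun i => f (i + 1)) fun i => hf _]
    simp_rw [e2]

/-- The Markov property at time `1`. -/
theorem map_shift_pathLaw (x : X) :
    (pathLaw P x).map (fun ω n => ω (n + 1)) = (P x).bind (pathLaw P) := by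
  have hs : Measurable fun (ω : ℕ → X) (n : ℕ) => ω (n + 1) := by fun_prop
  have hK := measurable_pathLaw P
  refine ext_of_generate_finite _
    generateFrom_squareCylinders.symm
    (isPiSystem_squareCylinders (fun _ => MeasurableSpace.isPiSystem_measurableSet) (by simp)) ?_ ?_
  · rintro S ⟨s, t, ht, rfl⟩
    classical
    simp only [Set.mem_univ_pi, Set.mem_ofPred_eq] at ht
    have hS : MeasurableSet ((s : Set ℕ).pi t) := MeasurableSet.pi s.countable_toSet fun i _ => ht i
    obtain ⟨n, hn⟩ : ∃ n, s ⊆ Finset.range (n + 1) := by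
      obtain ⟨n, hn⟩ := s.exists_nat_subset_range
      exact ⟨n, hn.trans (Finset.range_mono n.le_succ)⟩
    let g : ℕ → X → ℝ≥0∞ := fun i => if i ∈ s then (t i).indicator 1 else 1
    have hg : ∀ i, Measurable (g i) := fun i => by
      by_cases h : i ∈ s
      · simpa [g, h] using measurable_one.indicator (ht i)
      · simpa [g, h] using measurable_one
    have hind : ∀ ω : ℕ → X, ((s : Set ℕ).pi t).indicator (1 : (ℕ → X) → ℝ≥0∞) ω =
        ∏ i ∈ Finset.range (n + 1), g i (ω i) := fun ω => by
      by_cases h : ω ∈ (s : Set ℕ).pi t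
      · rw [Set.indicator_of_mem h, Finset.prod_eq_one]
        · rfl
        intro i _
        by_cases hi : i ∈ s
        · simp [g, hi, Set.indicator_of_mem (h i hi)]
        · simp [g, hi]
      · rw [Set.indicator_of_notMem h]
        simp only [Set.mem_pi, not_forall] at h
        obtain ⟨i, hi, hit⟩ := h
        refine (Finset.prod_eq_zero (hn hi) ?_).symm
        have hi' : i ∈ s := hi
        simp [g, hi', hit]
    rw [← lintegral_indicator_one hS, ← lintegral_indicator_one hS,
      lintegral_map (measurable_one.indicator hS) hs,
      Measure.lintegral_bind hK.aemeasurable (measurable_one.indicator hS).aemeasurable]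
    simp_rw [hind]
    -- The constant `1` is placed at time `0`, so the remaining factors are those of the shifted
    -- path.
    have := lintegral_prod_pathLaw_first_step P n x
      (fun i => match i with | 0 => 1 | i + 1 => g i)
      (fun i => by cases i; exacts [measurable_one, hg _])
    simp only [Pi.one_apply, one_mul] at this
    rw [← this]
    refine lintegral_congr fun ω => ?_
    rw [Finset.prod_range_succ' _ (n + 1)]
    simp
  · rw [Measure.map_apply hs MeasurableSet.univ, Measure.bind_apply MeasurableSet.univ
      hK.aemeasurable]
    simp

theorem lintegral_shift_pathLaw (x : X) {F : (ℕ → X) → ℝ≥0∞} (hF : Measurable F) :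
    ∫⁻ ω, F (fun n => ω (n + 1)) ∂(pathLaw P x) = ∫⁻ y, ∫⁻ ω, F ω ∂(pathLaw P y) ∂(P x) := by
  have hs : Measurable fun (ω : ℕ → X) (n : ℕ) => ω (n + 1) := by fun_prop
  rw [← lintegral_map (f := F) hF hs, map_shift_pathLaw,
    Measure.lintegral_bind (measurable_pathLaw P).aemeasurable hF.aemeasurable]

/-- The Markov property at time `n`. -/
theorem lintegral_shift_add_pathLaw (n : ℕ) (x : X) {F : (ℕ → X) → ℝ≥0∞} (hF : Measurable F) :
    ∫⁻ ω, F (fun k => ω (k + n)) ∂(pathLaw P x) =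
      ∫⁻ y, ∫⁻ ω, F ω ∂(pathLaw P y) ∂((P ^ n) x) := by
  have hm : Measurable fun y => ∫⁻ ω, F ω ∂(pathLaw P y) := by
    simpa only [pathKernel_apply] using hF.lintegral_kernel (κ := pathKernel P)
  induction n generalizing x with
  | zero =>
    rw [pow_zero]
    exact (Kernel.lintegral_id' hm x).symm
  | succ n ih =>
    have := lintegral_shift_pathLaw P x (F := fun ω => F fun k => ω (k + n)) (by fun_prop)
    simp only at this
    rw [Kernel.pow_add, pow_one, Kernel.lintegral_comp _ _ _ hm]
    simp_rw [← ih, ← this]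
    rfl

end MarkovChain

namespace MarkovChain

variable {X : Type*}

/-! ### First-step analysis of return times -/

theorem measurable_returnTime [MeasurableSpace X] {A : Set X} (hA : MeasurableSet A) : Measurable (returnTime A) := by
  -- Measurability of a countable infimum needs the Borel structure; as `ℕ∞` is countable with Borel
  -- singletons, that structure is discrete.
  have : BorelSpace ℕ∞ := by
    refine ⟨le_antisymm (fun s _ => ?_) le_top⟩
    have h1 : ∀ t : ℕ∞, MeasurableSet[borel ℕ∞] {t} := fun t => by
      have h := MeasurableSpace.measurableSet_generateFrom
        (isClosed_singleton (x := t)).isOpen_compl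
      simpa using MeasurableSet.compl (m := borel ℕ∞) h
    rw [← Set.biUnion_of_singleton s]
    exact MeasurableSet.biUnion (m := borel ℕ∞) s.to_countable fun t _ => h1 t
  classical
  have h : returnTime A = fun ω => ⨅ n : ℕ, if 1 ≤ n ∧ ω n ∈ A then (n : ℕ∞) else ⊤ := by
    funext ω
    exact iInf_congr fun n => iInf_eq_if _
  rw [h]
  refine Measurable.iInf fun n => Measurable.ite ?_ measurable_const measurable_const
  exact (MeasurableSet.const _).inter (measurable_pi_apply n hA)

theorem returnTime_of_mem {A : Set X} {ω : ℕ → X} (h : ω 1 ∈ A) : returnTime A ω = 1 := by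
  refine le_antisymm ((iInf₂_le 1 ⟨le_rfl, h⟩).trans (by simp)) ?_
  exact le_iInf₂ fun n hn => by exact_mod_cast hn.1

theorem returnTime_of_notMem {A : Set X} {ω : ℕ → X} (h : ω 1 ∉ A) :
    returnTime A ω = 1 + returnTime A (fun n => ω (n + 1)) := by
  refine le_antisymm ?_ (le_iInf₂ fun n hn => ?_)
  · by_cases ht : returnTime A (fun n => ω (n + 1)) = ⊤
    · simp [ht]
    · unfold returnTime at ht ⊢
      have hex : ∃ n : ℕ, 1 ≤ n ∧ ω (n + 1) ∈ A := by
        by_contra hne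
        push Not at hne
        exact ht (by simp only [iInf_eq_top]; exact fun n hn => absurd hn.2 (hne n hn.1))
      rw [ENat.add_iInf]
      refine le_iInf fun n => ?_
      by_cases hn : 1 ≤ n ∧ ω (n + 1) ∈ A
      · simp only [hn, and_self, iInf_pos]
        refine (iInf₂_le (n + 1) ⟨by omega, hn.2⟩).trans ?_
        push_cast
        rw [add_comm]
      · simp [hn]
  · obtain ⟨m, rfl⟩ : ∃ m, n = m + 1 := ⟨n - 1, by omega⟩
    have hm : m ≠ 0 := fun h0 => h (by simpa [h0] using hn.2)
    have h1 : returnTime A (fun n => ω (n + 1)) ≤ (m : ℕ∞) :=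
      iInf₂_le m ⟨Nat.one_le_iff_ne_zero.2 hm, hn.2⟩
    push_cast
    rw [add_comm]
    gcongr

theorem toENNReal_returnTime (A : Set X) (ω : ℕ → X) : (returnTime A ω : ℝ≥0∞) =
    1 + Aᶜ.indicator (fun _ => (returnTime A (fun n => ω (n + 1)) : ℝ≥0∞)) (ω 1) := by
  by_cases h : ω 1 ∈ A
  · simp [returnTime_of_mem h, h]
  · simp [returnTime_of_notMem h, h]

theorem powTime_one_add (r : ℝ≥0) (hr : r ≠ 0) (t : ℕ∞) :
    powTime r (1 + t) = r * powTime r t := by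
  induction t using ENat.recTopCoe with
  | top => simp [powTime, hr]
  | coe n =>
    have h1 : (1 + (n : ℕ∞)) ≠ ⊤ := by exact_mod_cast ENat.natCast_ne_top (1 + n)
    have h2 : (1 + (n : ℕ∞)).toNat = n + 1 := by
      have : (1 + (n : ℕ∞)) = ((n + 1 : ℕ) : ℕ∞) := by push_cast; ring
      rw [this, ENat.toNat_natCast]
    simp [powTime, h1, h2, pow_succ, mul_comm]

theorem one_le_powTime {r : ℝ≥0} (hr : 1 ≤ r) (t : ℕ∞) : 1 ≤ powTime r t := by
  unfold powTime
  split_ifs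
  · exact le_top
  · exact one_le_pow₀ (by exact_mod_cast hr)

variable [MeasurableSpace X]

theorem measurable_toENNReal_returnTime {A : Set X} (hA : MeasurableSet A) :
    Measurable fun ω : ℕ → X => (returnTime A ω : ℝ≥0∞) :=
  (measurable_of_countable (fun t : ℕ∞ => (t : ℝ≥0∞))).comp (measurable_returnTime hA)

theorem measurable_powTime_returnTime {A : Set X} (hA : MeasurableSet A) (r : ℝ≥0) :
    Measurable fun ω : ℕ → X => powTime r (returnTime A ω) :=
  (measurable_of_countable (powTime r)).comp (measurable_returnTime hA)

variable (P : Kernel X X) [IsMarkovKernel P]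

theorem measurable_lintegral_pathLaw {F : (ℕ → X) → ℝ≥0∞} (hF : Measurable F) :
    Measurable fun x => ∫⁻ ω, F ω ∂(pathLaw P x) := by
  simpa only [pathKernel_apply] using hF.lintegral_kernel (κ := pathKernel P)

theorem ae_pathLaw_zero_mem_iff {A : Set X} (hA : MeasurableSet A) (x : X) :
    ∀ᵐ ω ∂(pathLaw P x), (ω 0 ∈ A ↔ x ∈ A) := by
  classical
  have hB : ∀ B : Set X, MeasurableSet B → x ∉ B → ∀ᵐ ω ∂(pathLaw P x), ω 0 ∉ B := by
    intro B hB hx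
    have hm : Measurable (B.indicator (1 : X → ℝ≥0∞)) := measurable_one.indicator hB
    have h := lintegral_pathLaw_zero P x hm
    rw [Set.indicator_of_notMem hx, lintegral_eq_zero_iff (by fun_prop)] at h
    filter_upwards [h] with ω hω hmem
    simp [hmem] at hω
  by_cases hx : x ∈ A
  · filter_upwards [hB Aᶜ hA.compl (by simpa using hx)] with ω hω
    simpa [hx] using hω
  · filter_upwards [hB A hA hx] with ω hω
    simp [hx, hω]

/-- A functional killed upon entering `A` at time `1`, integrated by the Markov property. -/
theorem lintegral_indicator_shift_pathLaw {A : Set X} (hA : MeasurableSet A) (x : X)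
    {F : (ℕ → X) → ℝ≥0∞} (hF : Measurable F) :
    ∫⁻ ω, Aᶜ.indicator (fun _ => F fun n => ω (n + 1)) (ω 1) ∂(pathLaw P x) =
      ∫⁻ y in Aᶜ, ∫⁻ ω, F ω ∂(pathLaw P y) ∂(P x) := by
  have hm : Measurable fun ω : ℕ → X => Aᶜ.indicator (fun _ => F ω) (ω 0) := by
    have : (fun ω : ℕ → X => Aᶜ.indicator (fun _ => F ω) (ω 0)) =
        ((fun ω : ℕ → X => ω 0) ⁻¹' Aᶜ).indicator F := by
      funext ω; rfl
    rw [this]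
    exact hF.indicator (measurable_pi_apply 0 hA.compl)
  have := lintegral_shift_pathLaw P x hm
  simp only [zero_add] at this
  rw [this, ← lintegral_indicator hA.compl]
  refine lintegral_congr fun y => ?_
  by_cases hy : y ∈ A
  · rw [Set.indicator_of_notMem (by simpa using hy), lintegral_eq_zero_iff hm]
    filter_upwards [ae_pathLaw_zero_mem_iff P hA y] with ω hω
    simp [hω, hy]
  · rw [Set.indicator_of_mem (by simpa using hy)]
    refine lintegral_congr_ae ?_
    filter_upwards [ae_pathLaw_zero_mem_iff P hA y] with ω hω
    simp [hω, hy]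

theorem measurable_meanReturnTime {A : Set X} (hA : MeasurableSet A) :
    Measurable (meanReturnTime P A) :=
  measurable_lintegral_pathLaw P (measurable_toENNReal_returnTime hA)

theorem meanReturnTime_first_step {A : Set X} (hA : MeasurableSet A) (x : X) :
    meanReturnTime P A x = 1 + ∫⁻ y in Aᶜ, meanReturnTime P A y ∂(P x) := by
  have h := lintegral_indicator_shift_pathLaw P hA x (measurable_toENNReal_returnTime hA)
  unfold meanReturnTime
  rw [← h]
  rw [lintegral_congr (toENNReal_returnTime A), lintegral_add_left measurable_const]
  simp

/-- `𝔼_x [min (τ_A^+, N)]`. -/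
def truncMeanReturnTime (A : Set X) (N : ℕ) (x : X) : ℝ≥0∞ :=
  ∫⁻ ω, min (returnTime A ω : ℝ≥0∞) N ∂(pathLaw P x)

/-- Truncation turns the implicit equation for the mean into a recursion in `N` starting from zero,
so that supersolutions can be compared with it by induction. -/
theorem truncMeanReturnTime_succ {A : Set X} (hA : MeasurableSet A) (N : ℕ) (x : X) :
    truncMeanReturnTime P A (N + 1) x = 1 + ∫⁻ y in Aᶜ, truncMeanReturnTime P A N y ∂(P x) := by
  have hm : Measurable fun ω : ℕ → X => min (returnTime A ω : ℝ≥0∞) N :=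
    (measurable_toENNReal_returnTime hA).min measurable_const
  have h := lintegral_indicator_shift_pathLaw P hA x hm
  unfold truncMeanReturnTime
  rw [← h]
  have e : ∀ ω : ℕ → X, min (returnTime A ω : ℝ≥0∞) (N + 1 : ℕ) =
      1 + Aᶜ.indicator (fun _ => min (returnTime A (fun n => ω (n + 1)) : ℝ≥0∞) N) (ω 1) := by
    intro ω
    rw [toENNReal_returnTime]
    push_cast
    rw [add_comm (N : ℝ≥0∞) 1, min_add_add_left]
    by_cases h : ω 1 ∈ A <;> simp [h]
  simp_rw [e]
  rw [lintegral_add_left measurable_const]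
  simp

theorem meanReturnTime_eq_iSup {A : Set X} (hA : MeasurableSet A) (x : X) :
    meanReturnTime P A x = ⨆ N, truncMeanReturnTime P A N x := by
  unfold meanReturnTime truncMeanReturnTime
  rw [← lintegral_iSup (fun N => (measurable_toENNReal_returnTime hA).min measurable_const)]
  · refine lintegral_congr fun ω => ?_
    rw [← inf_iSup_eq, ENNReal.iSup_natCast, inf_top_eq]
  · intro M N h ω
    exact min_le_min le_rfl (by exact_mod_cast h)

/-- The Lyapunov criterion for mean return times. -/
theorem meanReturnTime_le_of_drift {A : Set X} (hA : MeasurableSet A) {f : X → ℝ≥0∞}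
    (hf : ∀ x ∉ A, 1 + ∫⁻ y in Aᶜ, f y ∂(P x) ≤ f x) {x : X} (hx : x ∉ A) :
    meanReturnTime P A x ≤ f x := by
  rw [meanReturnTime_eq_iSup P hA]
  refine iSup_le fun N => ?_
  induction N generalizing x with
  | zero => simp [truncMeanReturnTime]
  | succ N ih =>
    rw [truncMeanReturnTime_succ P hA]
    refine le_trans ?_ (hf x hx)
    gcongr 1 + ?_
    exact setLIntegral_mono' hA.compl fun y hy => ih hy

theorem one_le_geomMoment {r : ℝ≥0} (hr : 1 ≤ r) (A : Set X) (x : X) :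
    1 ≤ geomMoment P r A x := by
  calc (1 : ℝ≥0∞) = ∫⁻ _, 1 ∂(pathLaw P x) := by simp
    _ ≤ _ := lintegral_mono fun ω => one_le_powTime hr _

/-- Only an inequality, because paths that enter `A` at time `1` are discarded; lower bounds need no
more. -/
theorem le_geomMoment {A : Set X} (hA : MeasurableSet A) {r : ℝ≥0} (hr : 1 ≤ r) (x : X) :
    r * ∫⁻ y in Aᶜ, geomMoment P r A y ∂(P x) ≤ geomMoment P r A x := by
  have h := lintegral_indicator_shift_pathLaw P hA x (measurable_powTime_returnTime hA r)
  unfold geomMoment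
  rw [← h, ← lintegral_const_mul' _ _ ENNReal.coe_ne_top]
  refine lintegral_mono fun ω => ?_
  by_cases h : ω 1 ∈ A
  · simp [h]
  · simp [h, returnTime_of_notMem h, powTime_one_add r (zero_lt_one.trans_le hr).ne']

/-! ### Visits -/

/-- The probability of never visiting `A` at a time `n ≥ 1`. -/
def noVisit (A : Set X) (x : X) : ℝ≥0∞ :=
  pathLaw P x {ω | ∀ n, ω (n + 1) ∉ A}

theorem measurableSet_noVisit {A : Set X} (hA : MeasurableSet A) :
    MeasurableSet {ω : ℕ → X | ∀ n, ω (n + 1) ∉ A} := by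
  have : {ω : ℕ → X | ∀ n, ω (n + 1) ∉ A} = ⋂ n, (fun ω : ℕ → X => ω (n + 1)) ⁻¹' Aᶜ := by
    ext ω; simp
  rw [this]
  exact MeasurableSet.iInter fun n => measurable_pi_apply (n + 1) hA.compl

theorem measurable_noVisit {A : Set X} (hA : MeasurableSet A) : Measurable (noVisit P A) :=
  (pathKernel P).measurable_coe (measurableSet_noVisit hA)

theorem noVisit_le_one (A : Set X) (x : X) : noVisit P A x ≤ 1 := prob_le_one

theorem noVisit_first_step {A : Set X} (hA : MeasurableSet A) (x : X) :
    noVisit P A x = ∫⁻ y in Aᶜ, noVisit P A y ∂(P x) := by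
  have hS := measurableSet_noVisit hA
  have h := lintegral_indicator_shift_pathLaw P hA x
    ((measurable_one (α := ℝ≥0∞) (β := ℕ → X)).indicator hS)
  simp_rw [lintegral_indicator_one hS] at h
  unfold noVisit
  rw [← h, ← lintegral_indicator_one hS]
  refine lintegral_congr fun ω => ?_
  have hiff : (∀ n, ω (n + 1) ∉ A) ↔ ω 1 ∉ A ∧ ∀ n, ω (n + 1 + 1) ∉ A :=
    ⟨fun h' => ⟨h' 0, fun n => h' (n + 1)⟩, fun h' n => by
      cases n with
      | zero => exact h'.1
      | succ n => exact h'.2 n⟩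
  classical
  by_cases h1 : ω 1 ∈ A <;> simp [Set.indicator_apply, hiff, h1]

/-- Avoidance is required only from time `m + 1` onwards; the constraint at earlier times is
dropped. -/
theorem noVisit_le_pow {A : Set X} (hA : MeasurableSet A) (m : ℕ) (x : X) :
    noVisit P A x ≤ ∫⁻ y in Aᶜ, noVisit P A y ∂((P ^ (m + 1)) x) := by
  induction m generalizing x with
  | zero => rw [zero_add, pow_one]; exact (noVisit_first_step P hA x).le
  | succ m ih =>
    rw [← lintegral_indicator hA.compl, Kernel.pow_add P (m + 1) 1, pow_one, Kernel.lintegral_comp _ _ _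
      ((measurable_noVisit P hA).indicator hA.compl), noVisit_first_step P hA x]
    refine (setLIntegral_le_lintegral _ _).trans (lintegral_mono fun y => ?_)
    rw [lintegral_indicator hA.compl]
    exact ih y

/-- The Markov property at each time `m` gives a visit after `m` almost surely; intersecting over
all `m` excludes a finite number of visits. -/
theorem ae_tsum_visits_eq_top {A : Set X} (hA : MeasurableSet A) (h0 : ∀ x, noVisit P A x = 0)
    (x : X) :
    ∀ᵐ ω ∂(pathLaw P x), ∑' n : ℕ, A.indicator (fun _ => (1 : ℝ≥0∞)) (ω (n + 1)) = ∞ := by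
  have hS := measurableSet_noVisit hA
  have h : ∀ m, ∀ᵐ ω ∂(pathLaw P x), ∃ n, ω (n + 1 + m) ∈ A := by
    intro m
    have := lintegral_shift_add_pathLaw P m x
      ((measurable_one (α := ℝ≥0∞) (β := ℕ → X)).indicator hS)
    simp_rw [lintegral_indicator_one hS] at this
    change _ = ∫⁻ y, noVisit P A y ∂_ at this
    simp_rw [h0, lintegral_zero] at this
    have hshift : Measurable fun (ω : ℕ → X) k => ω (k + m) := by fun_prop
    rw [lintegral_eq_zero_iff
      (((measurable_one (α := ℝ≥0∞) (β := ℕ → X)).indicator hS).fun_comp hshift)] at this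
    filter_upwards [this] with ω hω
    by_contra hne
    push Not at hne
    have : (fun k => ω (k + m)) ∈ {ω : ℕ → X | ∀ n, ω (n + 1) ∉ A} := hne
    simp only [Set.indicator_of_mem this] at hω
    simp at hω
  filter_upwards [ae_all_iff.2 h] with ω hω
  by_contra hne
  have ht := ENNReal.tendsto_atTop_zero_of_tsum_ne_top hne
  have hev : ∀ᶠ n in atTop, A.indicator (fun _ => (1 : ℝ≥0∞)) (ω (n + 1)) < 1 :=
    ht.eventually_lt_const zero_lt_one
  obtain ⟨N, hN⟩ := eventually_atTop.1 hev
  obtain ⟨n, hn⟩ := hω N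
  have := hN (n + N) (by omega)
  rw [show n + N + 1 = n + 1 + N by ring] at this
  simp [hn] at this

theorem lintegral_tsum_visits {A : Set X} (hA : MeasurableSet A) (x : X) :
    ∫⁻ ω, ∑' n : ℕ, A.indicator (fun _ => (1 : ℝ≥0∞)) (ω (n + 1)) ∂(pathLaw P x) =
      ∑' n : ℕ, (P ^ (n + 1)) x A := by
  have hm : Measurable (A.indicator fun _ => (1 : ℝ≥0∞)) := measurable_const.indicator hA
  rw [lintegral_tsum fun n => (hm.fun_comp (measurable_pi_apply (n + 1))).aemeasurable]
  refine tsum_congr fun n => ?_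
  have := lintegral_shift_add_pathLaw P (n + 1) x (F := fun ω => A.indicator (fun _ => 1) (ω 0))
    (hm.comp (measurable_pi_apply 0))
  simp only [zero_add] at this
  rw [this]
  simp_rw [lintegral_pathLaw_zero P _ hm]
  rw [lintegral_indicator hA]
  simp

theorem IsHarrisRecurrent.isRecurrent {ψ : Measure X} (h : IsHarrisRecurrent P ψ) :
    IsRecurrent P ψ := by
  intro x A hA hψ
  rw [← lintegral_tsum_visits P hA, lintegral_congr_ae (h x A hA hψ)]
  simp

end MarkovChain

/-! ### Maximal irreducibility measures from an accessible point -/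

namespace MarkovChain

variable {X : Type*} [MeasurableSpace X] (P : Kernel X X)

theorem pow_succ_apply_first_step (n : ℕ) (x : X) {A : Set X} (hA : MeasurableSet A) :
    (P ^ (n + 1)) x A = ∫⁻ y, (P ^ n) y A ∂(P x) := by
  rw [add_comm, Kernel.pow_add_apply_eq_lintegral P 1 n x hA, pow_one]

theorem isMarkovKernel_pow [IsMarkovKernel P] (n : ℕ) : IsMarkovKernel (P ^ n) := by
  induction n with
  | zero => rw [pow_zero]; exact inferInstanceAs (IsMarkovKernel Kernel.id)
  | succ n ih => rw [Kernel.pow_add, pow_one]; infer_instance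

/-- An accessible point gives rise to a maximal irreducibility measure. -/
theorem exists_isMaximalIrreducibilityMeasure [MeasurableSingletonClass X] [IsMarkovKernel P]
    (a : X) (ha : ∀ x, ∃ k : ℕ, 0 < (P ^ (k + 1)) x {a}) :
    ∃ ψ : Measure X, IsMaximalIrreducibilityMeasure P ψ := by
  -- Only the null sets matter: a set is null exactly when it is never reached from `a`. The weights
  -- make the measure a probability.
  let ψ : Measure X := Measure.sum fun n : ℕ => ((2 : ℝ≥0∞)⁻¹ ^ (n + 1)) • (P ^ (n + 1)) a
  have hψ : ∀ A, MeasurableSet A → ψ A = ∑' n : ℕ, (2 : ℝ≥0∞)⁻¹ ^ (n + 1) * (P ^ (n + 1)) a A :=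
    fun A hA => by simp [ψ, Measure.sum_apply _ hA]
  have huniv : ψ Set.univ = 1 := by
    rw [hψ _ MeasurableSet.univ]
    have : ∀ n : ℕ, (P ^ (n + 1)) a Set.univ = 1 := fun n => by
      have := isMarkovKernel_pow P (n + 1); simp
    simp_rw [this, mul_one]
    rw [ENNReal.tsum_geometric_add_one, ENNReal.one_sub_inv_two, inv_inv,
      ENNReal.inv_mul_cancel two_ne_zero ENNReal.ofNat_ne_top]
  have hfin : IsProbabilityMeasure ψ := ⟨huniv⟩
  have hpos : ∀ A, MeasurableSet A → (ψ A = 0 ↔ ∀ n : ℕ, (P ^ (n + 1)) a A = 0) := by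
    intro A hA
    rw [hψ A hA, ENNReal.tsum_eq_zero]
    refine forall_congr' fun n => ?_
    have : (2 : ℝ≥0∞)⁻¹ ^ (n + 1) ≠ 0 := pow_ne_zero _ (by simp)
    simp [this]
  refine ⟨ψ, ⟨inferInstance, IsProbabilityMeasure.ne_zero ψ, fun A hA h x => ?_⟩, fun φ hφ => ?_⟩
  · obtain ⟨n, hn⟩ := not_forall.1 fun h0 => h.ne' ((hpos A hA).2 h0)
    obtain ⟨k, hk⟩ := ha x
    have hle : (P ^ (k + 1)) x {a} * (P ^ (n + 1)) a A ≤ (P ^ (k + 1 + n + 1)) x A := by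
      rw [add_assoc (k + 1), Kernel.pow_add_apply_eq_lintegral P (k + 1) (n + 1) x hA]
      calc (P ^ (k + 1)) x {a} * (P ^ (n + 1)) a A
          = ∫⁻ b in {a}, (P ^ (n + 1)) b A ∂((P ^ (k + 1)) x) := by
            rw [lintegral_singleton, mul_comm]
        _ ≤ _ := setLIntegral_le_lintegral _ _
    refine lt_of_lt_of_le ?_ (ENNReal.le_tsum (k + 1 + n))
    exact (ENNReal.mul_pos hk.ne' hn).trans_le hle
  · refine Measure.AbsolutelyContinuous.mk fun A hA h0 => ?_
    by_contra hne
    have := hφ.pos A hA (pos_iff_ne_zero.2 hne) a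
    rw [ENNReal.tsum_eq_zero.2 ((hpos A hA).1 h0)] at this
    exact lt_irrefl _ this

/-- The Dirac mass at an accessible point is itself an irreducibility measure, so a maximal one
dominates it. -/
theorem IsMaximalIrreducibilityMeasure.singleton_pos [MeasurableSingletonClass X]
    {ψ : Measure X} (hψ : IsMaximalIrreducibilityMeasure P ψ)
    (a : X) (ha : ∀ x, ∃ k : ℕ, 0 < (P ^ (k + 1)) x {a}) : 0 < ψ {a} := by
  have hirr : IsIrreducibilityMeasure P (Measure.dirac a) :=
    ⟨inferInstance, IsProbabilityMeasure.ne_zero _, fun A hA h x => by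
      obtain ⟨k, hk⟩ := ha x
      have haA : a ∈ A := by
        by_contra hne
        simp [Measure.dirac_apply' _ hA, hne] at h
      refine (hk.trans_le ?_).trans_le (ENNReal.le_tsum k)
      exact measure_mono (Set.singleton_subset_iff.2 haA)⟩
  refine pos_iff_ne_zero.2 fun h0 => ?_
  have := hψ.maximal _ hirr h0
  simp at this

end MarkovChain

/-! ### The kernel of the chain and the accessibility of `0` -/

namespace JumpChain

variable {γ : ℝ≥0 → ℝ} {β : ℝ≥0 → ℝ≥0} {hγ : Continuous γ} {hγ01 : ∀ x, 0 < γ x ∧ γ x < 1}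
  {hβ : ∫⁻ y, (β y : ℝ≥0∞) ∂lebesgue = 1}

theorem lebesgue_singleton (x : ℝ≥0) : lebesgue {x} = 0 := by
  have he : MeasurableEmbedding ((↑) : ℝ≥0 → ℝ) := MeasurableEmbedding.subtype_coe measurableSet_Ici
  rw [lebesgue, he.comap_apply]
  simp

theorem kernel_zero :
    kernel γ β hγ hγ01 hβ 0 = lebesgue.withDensity (fun y => (β y : ℝ≥0∞)) := by
  change transition γ β 0 = _
  simp [transition]

theorem ae_kernel_zero_ne_zero : ∀ᵐ y ∂(kernel γ β hγ hγ01 hβ 0), y ≠ 0 := by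
  rw [kernel_zero]
  refine (withDensity_absolutelyContinuous _ _).ae_le ?_
  exact compl_mem_ae_iff.2 (lebesgue_singleton 0)

theorem lintegral_kernel_zero (hβm : Measurable β) {f : ℝ≥0 → ℝ≥0∞} (hf : Measurable f) :
    ∫⁻ y, f y ∂(kernel γ β hγ hγ01 hβ 0) = ∫⁻ y, β y * f y ∂lebesgue := by
  rw [kernel_zero, lintegral_withDensity_eq_lintegral_mul _ (by fun_prop) hf]
  rfl

theorem lintegral_kernel_of_ne_zero {x : ℝ≥0} (hx : x ≠ 0) (f : ℝ≥0 → ℝ≥0∞) :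
    ∫⁻ y, f y ∂(kernel γ β hγ hγ01 hβ x) =
      ENNReal.ofReal (γ x) * f 0 + ENNReal.ofReal (1 - γ x) * f (x + 1) := by
  have : kernel γ β hγ hγ01 hβ x = ENNReal.ofReal (γ x) • Measure.dirac 0 +
      ENNReal.ofReal (1 - γ x) • Measure.dirac (x + 1) := by
    change transition γ β x = _
    simp [transition, hx]
  rw [this, lintegral_add_measure, lintegral_smul_measure, lintegral_smul_measure,
    lintegral_dirac, lintegral_dirac]
  rfl

/-- Jumps out of `0` have a density and so miss `0` almost surely. Bounds proved only on the
climbing part of the space are therefore enough. -/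
theorem lintegral_kernel_zero_le {f g : ℝ≥0 → ℝ≥0∞} (h : ∀ x ≠ 0, f x ≤ g x) :
    ∫⁻ y, f y ∂(kernel γ β hγ hγ01 hβ 0) ≤ ∫⁻ y, g y ∂(kernel γ β hγ hγ01 hβ 0) := by
  refine lintegral_mono_ae ?_
  filter_upwards [ae_kernel_zero_ne_zero] with y hy using h y hy

theorem kernel_singleton_zero {x : ℝ≥0} (hx : x ≠ 0) :
    kernel γ β hγ hγ01 hβ x {0} = ENNReal.ofReal (γ x) := by
  rw [← lintegral_indicator_one (measurableSet_singleton 0), lintegral_kernel_of_ne_zero hx]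
  simp

theorem zero_accessible (x : ℝ≥0) : ∃ k : ℕ, 0 < ((kernel γ β hγ hγ01 hβ) ^ (k + 1)) x {0} := by
  set P := kernel γ β hγ hγ01 hβ with hP
  by_cases hx : x = 0
  · subst hx
    refine ⟨1, pos_iff_ne_zero.2 fun h0 => ?_⟩
    rw [MarkovChain.pow_succ_apply_first_step P 1 0 (measurableSet_singleton 0), pow_one,
      lintegral_eq_zero_iff (P.measurable_coe (measurableSet_singleton 0))] at h0
    have : ∀ᵐ y ∂(P 0), False := by
      filter_upwards [h0, ae_kernel_zero_ne_zero (hγ := hγ) (hγ01 := hγ01) (hβ := hβ)] with y hy hy0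
      rw [hP, kernel_singleton_zero hy0] at hy
      simp [(hγ01 y).1.not_ge] at hy
    simp at this
    exact IsProbabilityMeasure.ne_zero (P 0) this
  · refine ⟨0, ?_⟩
    rw [zero_add, pow_one, hP, kernel_singleton_zero hx]
    exact ENNReal.ofReal_pos.2 (hγ01 x).1

end JumpChain

namespace JumpChain

open MarkovChain

/-! ### Climbing probabilities -/

/-- The probability of the first `n` jumps from `x > 0` all being upward. -/
def climb (γ : ℝ≥0 → ℝ) (n : ℕ) (x : ℝ≥0) : ℝ := ∏ j ∈ Finset.range n, (1 - γ (x + j))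

variable {γ : ℝ≥0 → ℝ}

theorem climb_succ (n : ℕ) (x : ℝ≥0) : climb γ (n + 1) x = (1 - γ x) * climb γ n (x + 1) := by
  unfold climb
  rw [Finset.prod_range_succ', mul_comm]
  congr 1
  · simp
  · refine Finset.prod_congr rfl fun j _ => ?_
    push_cast
    ring_nf

theorem climb_add (m n : ℕ) (x : ℝ≥0) : climb γ (m + n) x = climb γ m x * climb γ n (x + m) := by
  unfold climb
  rw [Finset.prod_range_add]
  congr 1
  refine Finset.prod_congr rfl fun j _ => ?_
  push_cast
  ring_nf

theorem climb_pos (hγ01 : ∀ x, 0 < γ x ∧ γ x < 1) (n : ℕ) (x : ℝ≥0) : 0 < climb γ n x :=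
  Finset.prod_pos fun _ _ => sub_pos.2 (hγ01 _).2

theorem climb_antitone (hγ01 : ∀ x, 0 < γ x ∧ γ x < 1) (x : ℝ≥0) :
    Antitone fun n => climb γ n x := by
  refine antitone_nat_of_succ_le fun n => ?_
  have h := climb_pos hγ01 n x
  unfold climb at h ⊢
  rw [Finset.prod_range_succ]
  exact mul_le_of_le_one_right h.le (by linarith [(hγ01 (x + n)).1])

theorem continuous_climb (hγ : Continuous γ) (n : ℕ) : Continuous (climb γ n) := by
  unfold climb
  fun_prop

theorem add_natCast_mem_Ico (x : ℝ≥0) (j : ℕ) :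
    x + j ∈ Set.Ico ((⌊x⌋₊ + j : ℕ) : ℝ≥0) ((⌊x⌋₊ + j : ℕ) + 1) := by
  have h1 := Nat.floor_le (zero_le (a := x))
  have h2 := Nat.lt_floor_add_one x
  constructor
  · push_cast; gcongr
  · push_cast
    calc x + j < (⌊x⌋₊ + 1) + j := by gcongr
      _ = _ := by ring

theorem bddAbove_image (hγ01 : ∀ x, 0 < γ x ∧ γ x < 1) (S : Set ℝ≥0) :
    BddAbove ((fun x : ℝ≥0 => 1 - γ x) '' S) :=
  ⟨1, by rintro _ ⟨x, _, rfl⟩; linarith [(hγ01 x).1]⟩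

theorem bddBelow_image (hγ01 : ∀ x, 0 < γ x ∧ γ x < 1) (S : Set ℝ≥0) :
    BddBelow ((fun x : ℝ≥0 => 1 - γ x) '' S) :=
  ⟨0, by rintro _ ⟨x, _, rfl⟩; linarith [(hγ01 x).2]⟩

/-- The climb from `x` meets each unit interval from index `⌊x⌋₊` on exactly once. The suprema are
positive, so finitely many factors can be inserted or cancelled without affecting convergence to
zero. -/
theorem tendsto_climb_of_tendsto_prod_sSup (hγ01 : ∀ x, 0 < γ x ∧ γ x < 1) {a : ℕ}
    (h : Tendsto (fun N : ℕ => ∏ k ∈ Finset.Ico a N,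
      sSup ((fun x : ℝ≥0 => 1 - γ x) '' Set.Ico (k : ℝ≥0) (k + 1))) atTop (𝓝 0)) (x : ℝ≥0) :
    Tendsto (fun n => climb γ n x) atTop (𝓝 0) := by
  set s : ℕ → ℝ := fun k => sSup ((fun x : ℝ≥0 => 1 - γ x) '' Set.Ico (k : ℝ≥0) (k + 1)) with hs
  have hle : ∀ k : ℕ, ∀ y ∈ Set.Ico (k : ℝ≥0) (k + 1), 1 - γ y ≤ s k := fun k y hy =>
    le_csSup (bddAbove_image hγ01 _) ⟨y, hy, rfl⟩
  have hpos : ∀ k, 0 < s k := fun k =>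
    (sub_pos.2 (hγ01 k).2).trans_le (hle k k ⟨le_rfl, lt_add_one _⟩)
  set b := ⌊x⌋₊ with hb
  have h0 : Tendsto (fun N => ∏ k ∈ Finset.Ico 0 N, s k) atTop (𝓝 0) := by
    have := h.const_mul (∏ k ∈ Finset.Ico 0 a, s k)
    rw [mul_zero] at this
    refine this.congr' ?_
    filter_upwards [eventually_ge_atTop a] with N hN
    exact Finset.prod_Ico_consecutive s (Nat.zero_le a) hN
  have h1 : Tendsto (fun n => ∏ k ∈ Finset.Ico b (b + n), s k) atTop (𝓝 0) := by
    have := (h0.comp (tendsto_add_atTop_nat b)).const_mul (∏ k ∈ Finset.Ico 0 b, s k)⁻¹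
    rw [mul_zero] at this
    refine this.congr fun n => ?_
    have hp : ∏ k ∈ Finset.Ico 0 b, s k ≠ 0 := (Finset.prod_pos fun k _ => hpos k).ne'
    simp only [Function.comp]
    rw [add_comm n b, ← Finset.prod_Ico_consecutive s (Nat.zero_le b) (Nat.le_add_right b n),
      inv_mul_cancel_left₀ hp]
  refine squeeze_zero (fun n => (climb_pos hγ01 n x).le) (fun n => ?_) h1
  rw [Finset.prod_Ico_eq_prod_range, Nat.add_sub_cancel_left]
  exact Finset.prod_le_prod (fun j _ => (sub_pos.2 (hγ01 _).2).le) fun j _ =>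
    hle _ _ (add_natCast_mem_Ico x j)

theorem exists_pos_le_climb_of_tendsto_prod_sInf (hγ01 : ∀ x, 0 < γ x ∧ γ x < 1) {a : ℕ} {p : ℝ}
    (hp : 0 < p) (h : Tendsto (fun N : ℕ => ∏ k ∈ Finset.Ico a N,
      sInf ((fun x : ℝ≥0 => 1 - γ x) '' Set.Ico (k : ℝ≥0) (k + 1))) atTop (𝓝 p)) (x : ℝ≥0) :
    ∃ c : ℝ, 0 < c ∧ ∀ n, c ≤ climb γ n x := by
  set s : ℕ → ℝ := fun k => sInf ((fun x : ℝ≥0 => 1 - γ x) '' Set.Ico (k : ℝ≥0) (k + 1)) with hs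
  have hle : ∀ k : ℕ, ∀ y ∈ Set.Ico (k : ℝ≥0) (k + 1), s k ≤ 1 - γ y := fun k y hy =>
    csInf_le (bddBelow_image hγ01 _) ⟨y, hy, rfl⟩
  have h0 : ∀ k, 0 ≤ s k := fun k => Real.sInf_nonneg (by
    rintro _ ⟨y, _, rfl⟩; exact (sub_pos.2 (hγ01 y).2).le)
  have h1 : ∀ k, s k ≤ 1 := fun k =>
    (hle k k ⟨le_rfl, lt_add_one _⟩).trans (by linarith [(hγ01 k).1])
  have hlarge : ∀ y : ℝ≥0, a ≤ ⌊y⌋₊ → ∀ n, p ≤ climb γ n y := by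
    intro y hy n
    have hanti : Antitone fun N => ∏ k ∈ Finset.Ico a N, s k := fun M N hMN =>
      Finset.prod_le_prod_of_subset_of_le_one (Finset.Ico_subset_Ico le_rfl hMN)
        (fun k _ => h0 k) (fun k _ _ => h1 k)
    calc p ≤ ∏ k ∈ Finset.Ico a (⌊y⌋₊ + n), s k := hanti.le_of_tendsto h _
      _ = (∏ k ∈ Finset.Ico a ⌊y⌋₊, s k) * ∏ k ∈ Finset.Ico ⌊y⌋₊ (⌊y⌋₊ + n), s k :=
          (Finset.prod_Ico_consecutive s hy (Nat.le_add_right _ n)).symm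
      _ ≤ ∏ k ∈ Finset.Ico ⌊y⌋₊ (⌊y⌋₊ + n), s k :=
          mul_le_of_le_one_left (Finset.prod_nonneg fun k _ => h0 k)
            (Finset.prod_le_one (fun k _ => h0 k) fun k _ => h1 k)
      _ ≤ climb γ n y := by
          rw [Finset.prod_Ico_eq_prod_range, Nat.add_sub_cancel_left]
          exact Finset.prod_le_prod (fun j _ => h0 _) fun j _ => hle _ _ (add_natCast_mem_Ico y j)
  -- The bound `p` covers starting points beyond `a`; any other start first climbs `a` levels, at a
  -- positive cost.
  refine ⟨climb γ a x * p, mul_pos (climb_pos hγ01 a x) hp, fun n => ?_⟩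
  calc climb γ a x * p ≤ climb γ a x * climb γ n (x + a) := by
        refine mul_le_mul_of_nonneg_left (hlarge _ ?_ n) (climb_pos hγ01 a x).le
        exact Nat.le_floor (by simp)
    _ = climb γ (a + n) x := (climb_add a n x).symm
    _ ≤ climb γ n x := climb_antitone hγ01 x (Nat.le_add_left n a)

variable {β : ℝ≥0 → ℝ≥0} {hγ : Continuous γ} {hγ01 : ∀ x, 0 < γ x ∧ γ x < 1}
  {hβ : ∫⁻ y, (β y : ℝ≥0∞) ∂lebesgue = 1}

theorem ofReal_add_ofReal_one_sub (hγ01 : ∀ x, 0 < γ x ∧ γ x < 1) (x : ℝ≥0) :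
    ENNReal.ofReal (γ x) + ENNReal.ofReal (1 - γ x) = 1 := by
  rw [← ENNReal.ofReal_add (hγ01 x).1.le (sub_pos.2 (hγ01 x).2).le]
  simp

theorem ofReal_climb_succ (hγ01 : ∀ x, 0 < γ x ∧ γ x < 1) (n : ℕ) (x : ℝ≥0) :
    ENNReal.ofReal (climb γ (n + 1) x) =
      ENNReal.ofReal (1 - γ x) * ENNReal.ofReal (climb γ n (x + 1)) := by
  rw [climb_succ, ENNReal.ofReal_mul (sub_pos.2 (hγ01 x).2).le]

/-! ### Harris recurrence -/

/-- Either the chain falls to `0` within `n` steps and must avoid `A` from there, or it has climbed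
`n` times. -/
theorem noVisit_le_add_climb {A : Set ℝ≥0} (hA : MeasurableSet A) (n : ℕ) {x : ℝ≥0} (hx : x ≠ 0) :
    noVisit (kernel γ β hγ hγ01 hβ) A x ≤
      noVisit (kernel γ β hγ hγ01 hβ) A 0 + ENNReal.ofReal (climb γ n x) := by
  set P := kernel γ β hγ hγ01 hβ
  induction n generalizing x with
  | zero =>
    refine le_add_left ?_
    simpa [climb] using noVisit_le_one P A x
  | succ n ih =>
    calc noVisit P A x ≤ ∫⁻ y, noVisit P A y ∂(P x) :=
          (noVisit_first_step P hA x).le.trans (setLIntegral_le_lintegral _ _)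
      _ = ENNReal.ofReal (γ x) * noVisit P A 0 +
            ENNReal.ofReal (1 - γ x) * noVisit P A (x + 1) := lintegral_kernel_of_ne_zero hx _
      _ ≤ ENNReal.ofReal (γ x) * noVisit P A 0 + ENNReal.ofReal (1 - γ x) *
            (noVisit P A 0 + ENNReal.ofReal (climb γ n (x + 1))) := by
          gcongr
          exact ih (by positivity)
      _ = (ENNReal.ofReal (γ x) + ENNReal.ofReal (1 - γ x)) * noVisit P A 0 +
            ENNReal.ofReal (climb γ (n + 1) x) := by
          rw [ofReal_climb_succ hγ01]; ring
      _ = _ := by rw [ofReal_add_ofReal_one_sub hγ01, one_mul]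

theorem isHarrisRecurrent_of_tendsto_climb
    (h : ∀ x ≠ 0, Tendsto (fun n => climb γ n x) atTop (𝓝 0)) {ψ : Measure ℝ≥0}
    (hψ : IsIrreducibilityMeasure (kernel γ β hγ hγ01 hβ) ψ) :
    IsHarrisRecurrent (kernel γ β hγ hγ01 hβ) ψ := by
  set P := kernel γ β hγ hγ01 hβ
  intro x A hA hψA
  refine ae_tsum_visits_eq_top P hA ?_ x
  have hle : ∀ y, noVisit P A y ≤ noVisit P A 0 := by
    intro y
    by_cases hy : y = 0
    · rw [hy]
    · have ht : Tendsto (fun n => noVisit P A 0 + ENNReal.ofReal (climb γ n y)) atTop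
          (𝓝 (noVisit P A 0)) := by
        simpa using ((ENNReal.tendsto_ofReal (h y hy)).const_add (noVisit P A 0))
      exact ge_of_tendsto' ht fun n => noVisit_le_add_climb hA n hy
  have h0 : noVisit P A 0 = 0 := by
    obtain ⟨m, hm⟩ : ∃ m : ℕ, (P ^ (m + 1)) 0 A ≠ 0 := by
      by_contra hne
      push Not at hne
      exact (hψ.pos A hA hψA 0).ne' (ENNReal.tsum_eq_zero.2 hne)
    have := isMarkovKernel_pow P (m + 1)
    -- Since `0` is the worst starting point, the avoidance probability there contracts by a factor
    -- below one.
    have h1 : noVisit P A 0 ≤ noVisit P A 0 * (P ^ (m + 1)) 0 Aᶜ := by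
      refine (noVisit_le_pow P hA m 0).trans ((setLIntegral_mono' hA.compl fun y _ => hle y).trans ?_)
      simp
    have h2 : (P ^ (m + 1)) 0 Aᶜ < 1 := by
      rw [prob_compl_eq_one_sub hA]
      exact ENNReal.sub_lt_self ENNReal.one_ne_top one_ne_zero hm
    by_contra hne
    have hfin : noVisit P A 0 ≠ ∞ := ((noVisit_le_one P A 0).trans_lt ENNReal.one_lt_top).ne
    have := ENNReal.mul_lt_mul_right hne hfin h2
    rw [mul_one] at this
    exact absurd h1 this.not_ge
  exact fun y => le_antisymm (h0 ▸ hle y) (zero_le)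

/-! ### Transience -/

/-- The expected number of visits to `0` up to time `n`. -/
def visitsZero (P : Kernel ℝ≥0 ℝ≥0) (n : ℕ) (x : ℝ≥0) : ℝ≥0∞ :=
  ∑ k ∈ Finset.range n, (P ^ (k + 1)) x {0}

theorem visitsZero_succ (P : Kernel ℝ≥0 ℝ≥0) (n : ℕ) (x : ℝ≥0) :
    visitsZero P (n + 1) x =
      ∫⁻ y, (({0} : Set ℝ≥0).indicator 1 y + visitsZero P n y) ∂(P x) := by
  have h0 := measurableSet_singleton (0 : ℝ≥0)
  unfold visitsZero
  simp_rw [pow_succ_apply_first_step P _ _ h0]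
  rw [← lintegral_finsetSum _ fun k _ => (P ^ k).measurable_coe h0]
  refine lintegral_congr fun y => ?_
  rw [Finset.sum_range_succ', add_comm]
  congr 1
  · rw [pow_zero]
    exact (Kernel.id_apply y ▸ Measure.dirac_apply' y h0 :)
  · exact Finset.sum_congr rfl fun k _ => pow_succ_apply_first_step P k y h0

theorem visitsZero_mono (P : Kernel ℝ≥0 ℝ≥0) (x : ℝ≥0) : Monotone fun n => visitsZero P n x :=
  fun _ _ h => Finset.sum_le_sum_of_subset (Finset.range_mono h)

/-- With probability `climb γ n x` there is no visit at all; otherwise the first visit counts one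
and the chain restarts from `0` with fewer than `K` steps left. -/
theorem visitsZero_add_climb_le {n K : ℕ} (hn : n ≤ K) {x : ℝ≥0} (hx : x ≠ 0) :
    visitsZero (kernel γ β hγ hγ01 hβ) n x + ENNReal.ofReal (climb γ n x) *
      (1 + visitsZero (kernel γ β hγ hγ01 hβ) K 0) ≤
      1 + visitsZero (kernel γ β hγ hγ01 hβ) K 0 := by
  set P := kernel γ β hγ hγ01 hβ
  set M := 1 + visitsZero P K 0
  induction n generalizing x with
  | zero => simp [visitsZero, climb]
  | succ n ih =>
    have hx1 : x + 1 ≠ 0 := by positivity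
    have hstep : visitsZero P (n + 1) x = ENNReal.ofReal (γ x) * (1 + visitsZero P n 0) +
        ENNReal.ofReal (1 - γ x) * visitsZero P n (x + 1) := by
      rw [visitsZero_succ, lintegral_kernel_of_ne_zero hx]
      simp
    calc visitsZero P (n + 1) x + ENNReal.ofReal (climb γ (n + 1) x) * M
        = ENNReal.ofReal (γ x) * (1 + visitsZero P n 0) + ENNReal.ofReal (1 - γ x) *
          (visitsZero P n (x + 1) + ENNReal.ofReal (climb γ n (x + 1)) * M) := by
          rw [hstep, ofReal_climb_succ hγ01]; ring
      _ ≤ ENNReal.ofReal (γ x) * M + ENNReal.ofReal (1 - γ x) * M := by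
          gcongr
          · exact add_le_add_right (visitsZero_mono P 0 (by omega : n ≤ K)) 1
          · exact ih (by omega) hx1
      _ = M := by rw [← add_mul, ofReal_add_ofReal_one_sub hγ01, one_mul]

theorem isTransient_of_le_climb (h : ∀ x, ∃ c : ℝ, 0 < c ∧ ∀ n, c ≤ climb γ n x)
    {ψ : Measure ℝ≥0} (hψ : IsMaximalIrreducibilityMeasure (kernel γ β hγ hγ01 hβ) ψ) :
    IsTransient (kernel γ β hγ hγ01 hβ) ψ := by
  have hψ0 := hψ.singleton_pos _ 0 zero_accessible
  set P := kernel γ β hγ hγ01 hβ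
  intro hrec
  have htop := hrec 0 {0} (measurableSet_singleton 0) hψ0
  let H : ℝ≥0 → ℝ≥0∞ := fun x => ⨅ n, ENNReal.ofReal (climb γ n x)
  have hHm : Measurable H := Measurable.iInf fun n =>
    (continuous_climb hγ n).measurable.ennreal_ofReal
  have hHpos : ∀ x, 0 < H x := fun x => by
    obtain ⟨c, hc, hcn⟩ := h x
    exact (ENNReal.ofReal_pos.2 hc).trans_le
      (le_iInf fun n => ENNReal.ofReal_le_ofReal (hcn n))
  have hint : ∫⁻ y, H y ∂(P 0) ≠ 0 := fun h0 => by
    rw [lintegral_eq_zero_iff hHm] at h0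
    have : ∀ᵐ y ∂(P 0), False := by
      filter_upwards [h0] with y hy using (hHpos y).ne' hy
    simp at this
    exact IsProbabilityMeasure.ne_zero (P 0) this
  have hfin : ∀ N, visitsZero P N 0 ≠ ∞ := fun N => by
    refine ENNReal.sum_ne_top.2 fun k _ => ?_
    have := isMarkovKernel_pow P (k + 1)
    exact measure_ne_top _ _
  have hbound : ∀ N, visitsZero P N 0 ≤ (∫⁻ y, H y ∂(P 0))⁻¹ := fun N => by
    set M := 1 + visitsZero P N 0 with hM
    have hMfin : M ≠ ∞ := ENNReal.add_ne_top.2 ⟨ENNReal.one_ne_top, hfin N⟩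
    -- One excursion from `0` escapes with probability at least `∫ H`. Cancelling the finite count
    -- on both sides bounds `M` uniformly in `N`.
    have h1 : visitsZero P N 0 + (∫⁻ y, H y ∂(P 0)) * M ≤ visitsZero P N 0 + 1 := by
      calc visitsZero P N 0 + (∫⁻ y, H y ∂(P 0)) * M
          ≤ visitsZero P (N + 1) 0 + (∫⁻ y, H y ∂(P 0)) * M := by
            gcongr; exact visitsZero_mono P 0 N.le_succ
        _ = ∫⁻ y, (({0} : Set ℝ≥0).indicator 1 y + visitsZero P N y) + H y * M ∂(P 0) := by
            rw [lintegral_add_right _ (hHm.mul_const M), lintegral_mul_const _ hHm,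
              visitsZero_succ]
        _ ≤ ∫⁻ _, M ∂(P 0) := by
            refine lintegral_kernel_zero_le fun y hy => ?_
            refine le_trans ?_ (visitsZero_add_climb_le (le_refl N) hy)
            rw [Set.indicator_of_notMem (by simpa using hy), zero_add]
            gcongr
            exact iInf_le _ N
        _ = visitsZero P N 0 + 1 := by simp [hM, add_comm]
    have h2 : (∫⁻ y, H y ∂(P 0)) * M ≤ 1 := (ENNReal.add_le_add_iff_left (hfin N)).1 h1
    have hintfin : ∫⁻ y, H y ∂(P 0) ≠ ∞ := fun ht => by
      rw [ht, ENNReal.top_mul (by simp [hM])] at h2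
      simp at h2
    rw [ENNReal.le_inv_iff_mul_le, mul_comm]
    exact le_trans (by gcongr; exact le_add_self) h2
  have : ∑' n : ℕ, (P ^ (n + 1)) 0 {0} ≤ (∫⁻ y, H y ∂(P 0))⁻¹ :=
    ENNReal.tsum_le_of_sum_range_le hbound
  rw [htop, top_le_iff, ENNReal.inv_eq_top] at this
  exact hint this

end JumpChain

namespace JumpChain

open MarkovChain

/-! ### Petite sets when `γ` vanishes at infinity -/

variable {γ : ℝ≥0 → ℝ}

/-- `sup_{y ≥ x} γ y`. -/
def tailSup (γ : ℝ≥0 → ℝ) (x : ℝ≥0) : ℝ := sSup (γ '' Set.Ici x)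

theorem le_tailSup (hγ01 : ∀ x, 0 < γ x ∧ γ x < 1) {x y : ℝ≥0} (h : x ≤ y) : γ y ≤ tailSup γ x :=
  le_csSup ⟨1, by rintro _ ⟨z, _, rfl⟩; exact (hγ01 z).2.le⟩ ⟨y, h, rfl⟩

theorem tailSup_pos (hγ01 : ∀ x, 0 < γ x ∧ γ x < 1) (x : ℝ≥0) : 0 < tailSup γ x :=
  (hγ01 x).1.trans_le (le_tailSup hγ01 le_rfl)

theorem tailSup_le {x : ℝ≥0} {c : ℝ} (h : ∀ y, x ≤ y → γ y ≤ c) : tailSup γ x ≤ c :=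
  csSup_le ⟨_, x, Set.self_mem_Ici, rfl⟩ (by rintro _ ⟨z, hz, rfl⟩; exact h z hz)

theorem tailSup_le_one (hγ01 : ∀ x, 0 < γ x ∧ γ x < 1) (x : ℝ≥0) : tailSup γ x ≤ 1 :=
  tailSup_le fun y _ => (hγ01 y).2.le

theorem tailSup_antitone (hγ01 : ∀ x, 0 < γ x ∧ γ x < 1) : Antitone (tailSup γ) :=
  fun _ _ hxy => tailSup_le fun _ hz => le_tailSup hγ01 (hxy.trans hz)

theorem tendsto_tailSup (hγ01 : ∀ x, 0 < γ x ∧ γ x < 1) (h : Tendsto γ atTop (𝓝 0)) :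
    Tendsto (tailSup γ) atTop (𝓝 0) := by
  refine tendsto_order.2 ⟨fun c hc => Eventually.of_forall fun x => hc.trans (tailSup_pos hγ01 x),
    fun c hc => ?_⟩
  obtain ⟨x, hx⟩ := eventually_atTop.1 (h.eventually_lt_const (half_pos hc))
  filter_upwards [eventually_ge_atTop x] with y hy
  exact (tailSup_le fun z hz => (hx z (hy.trans hz)).le).trans_lt (half_lt_self hc)

variable {β : ℝ≥0 → ℝ≥0} {hγ : Continuous γ} {hγ01 : ∀ x, 0 < γ x ∧ γ x < 1}
  {hβ : ∫⁻ y, (β y : ℝ≥0∞) ∂lebesgue = 1}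

/-- Coming down below `R` requires a fall during one of the `n` steps; this is the union bound. -/
theorem kernel_pow_Iic_le {R : ℝ≥0} {s : ℝ} (n : ℕ) {x : ℝ≥0} (hx : R < x)
    (hs : ∀ y, x ≤ y → γ y ≤ s) :
    ((kernel γ β hγ hγ01 hβ) ^ n) x (Set.Iic R) ≤ n * ENNReal.ofReal s := by
  set P := kernel γ β hγ hγ01 hβ
  induction n generalizing x with
  | zero =>
    rw [pow_zero]
    change Kernel.id x (Set.Iic R) ≤ _
    rw [Kernel.id_apply, Measure.dirac_apply' _ measurableSet_Iic,
      Set.indicator_of_notMem (by simpa using hx)]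
    exact zero_le
  | succ n ih =>
    have hPn := isMarkovKernel_pow P n
    have hx1 : x ≤ x + 1 := le_add_of_nonneg_right zero_le_one
    rw [pow_succ_apply_first_step P n x measurableSet_Iic,
      lintegral_kernel_of_ne_zero (zero_le.trans_lt hx).ne']
    calc _ ≤ ENNReal.ofReal s * 1 + 1 * (n * ENNReal.ofReal s) := by
          gcongr
          · exact hs x le_rfl
          · exact prob_le_one
          · exact ENNReal.ofReal_le_one.2 (by linarith [(hγ01 x).1])
          · exact ih (hx.trans_le hx1) fun y hy => hs y (hx1.trans hy)
      _ = _ := by push_cast; ring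

/-- From far away, a fixed number of steps rarely leads to a bounded set. Along points of an
unbounded `C`, dominated convergence with weights `a n` would make `ν` vanish on every bounded
interval. -/
theorem bddAbove_of_isPetite (h : Tendsto γ atTop (𝓝 0)) {C : Set ℝ≥0}
    (hC : IsPetite (kernel γ β hγ hγ01 hβ) C) : BddAbove C := by
  set P := kernel γ β hγ hγ01 hβ
  obtain ⟨-, a, ν, hν, hle⟩ := hC
  by_contra hunb
  have hfreq : ∃ᶠ x in atTop, x ∈ C := by
    refine frequently_atTop.2 fun b => ?_
    obtain ⟨x, hx, hbx⟩ := not_bddAbove_iff.1 hunb b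
    exact ⟨x, hbx.le, hx⟩
  have hzero : ∀ R : ℕ, ν (Set.Iic (R : ℝ≥0)) = 0 := by
    intro R
    have hlim : ∀ n, Tendsto (fun x => a n * (P ^ n) x (Set.Iic (R : ℝ≥0))) atTop (𝓝 0) := by
      intro n
      have h1 : Tendsto (fun x => (n : ℝ≥0∞) * ENNReal.ofReal (tailSup γ x)) atTop (𝓝 0) := by
        have := ENNReal.Tendsto.const_mul (ENNReal.tendsto_ofReal (tendsto_tailSup hγ01 h))
          (Or.inr (ENNReal.natCast_ne_top n))
        simpa using this
      have h2 : Tendsto (fun x => (P ^ n) x (Set.Iic (R : ℝ≥0))) atTop (𝓝 0) := by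
        refine tendsto_of_tendsto_of_tendsto_of_le_of_le' tendsto_const_nhds h1
          (Eventually.of_forall fun _ => zero_le) ?_
        filter_upwards [eventually_gt_atTop (R : ℝ≥0)] with x hx
        exact kernel_pow_Iic_le n hx fun y hy => le_tailSup hγ01 hy
      simpa using ENNReal.Tendsto.const_mul h2 (Or.inr (a.apply_ne_top n))
    have hsum : Tendsto (fun x => ∑' n, a n * (P ^ n) x (Set.Iic (R : ℝ≥0))) atTop (𝓝 0) := by
      simp_rw [← lintegral_count]
      have := tendsto_lintegral_filter_of_dominated_convergence (μ := Measure.count)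
        (F := fun x n => a n * (P ^ n) x (Set.Iic (R : ℝ≥0))) (f := fun _ => 0) (l := atTop)
        (fun n => a n) (Eventually.of_forall fun x => measurable_of_countable _)
        (Eventually.of_forall fun x => ae_of_all _ fun n => by
          have := isMarkovKernel_pow P n
          exact mul_le_of_le_one_right zero_le prob_le_one)
        (by rw [lintegral_count, a.tsum_coe]; exact ENNReal.one_ne_top)
        (ae_of_all _ hlim)
      simpa using this
    exact le_antisymm (ge_of_tendsto_of_frequently hsum
      (hfreq.mono fun x hx => hle x hx _ measurableSet_Iic)) zero_le
  refine hν (Measure.measure_univ_eq_zero.1 ?_)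
  refine measure_mono_null (fun x _ => ?_) (measure_iUnion_null hzero)
  obtain ⟨n, hn⟩ := exists_nat_ge x
  exact Set.mem_iUnion.2 ⟨n, hn⟩

/-! ### Lower bounds for return times -/

theorem one_add_mul_le_meanReturnTime {C : Set ℝ≥0} (hC : MeasurableSet C) {x : ℝ≥0} (hx : x ≠ 0)
    (hxC : x + 1 ∉ C) :
    1 + ENNReal.ofReal (1 - γ x) * meanReturnTime (kernel γ β hγ hγ01 hβ) C (x + 1) ≤
      meanReturnTime (kernel γ β hγ hγ01 hβ) C x := by
  rw [meanReturnTime_first_step _ hC x, ← lintegral_indicator hC.compl,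
    lintegral_kernel_of_ne_zero hx, Set.indicator_of_mem (s := Cᶜ) (a := x + 1) hxC]
  gcongr
  exact le_add_self

/-- Above `C` the set can be reached only after a fall, whose probability at each step is at most
`tailSup γ x`. Iterating the one-step inequality yields the geometric series. -/
theorem inv_tailSup_le_meanReturnTime {C : Set ℝ≥0} (hC : MeasurableSet C) {R : ℝ≥0}
    (hR : ∀ y ∈ C, y ≤ R) {x : ℝ≥0} (hx : R < x) :
    (ENNReal.ofReal (tailSup γ x))⁻¹ ≤ meanReturnTime (kernel γ β hγ hγ01 hβ) C x := by
  set V := meanReturnTime (kernel γ β hγ hγ01 hβ) C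
  set s := ENNReal.ofReal (tailSup γ x) with hs
  have hs1 : s ≤ 1 := ENNReal.ofReal_le_one.2 (tailSup_le_one hγ01 x)
  have key : ∀ N : ℕ, ∀ y, x ≤ y → ∑ n ∈ Finset.range N, (1 - s) ^ n ≤ V y := by
    intro N
    induction N with
    | zero => simp
    | succ N ih =>
      intro y hy
      have hy1 : x ≤ y + 1 := hy.trans (le_add_of_nonneg_right zero_le_one)
      refine le_trans ?_ (one_add_mul_le_meanReturnTime hC (zero_le.trans_lt (hx.trans_le hy)).ne'
        fun hmem => (hR _ hmem).not_gt (hx.trans_le hy1))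
      rw [Finset.sum_range_succ', add_comm, pow_zero]
      simp_rw [pow_succ', ← Finset.mul_sum]
      gcongr
      · rw [ENNReal.ofReal_sub _ (hγ01 y).1.le, ENNReal.ofReal_one]
        exact tsub_le_tsub_left (ENNReal.ofReal_le_ofReal (le_tailSup hγ01 hy)) 1
      · exact ih _ hy1
  calc s⁻¹ = ∑' n : ℕ, (1 - s) ^ n := by
        rw [ENNReal.tsum_geometric, ENNReal.sub_sub_cancel ENNReal.one_ne_top hs1]
    _ ≤ V x := ENNReal.tsum_le_of_sum_range_le fun N => key N x le_rfl

theorem not_isStronglyErgodic (h : Tendsto γ atTop (𝓝 0)) :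
    ¬ IsStronglyErgodic (kernel γ β hγ hγ01 hβ) := by
  rintro ⟨C, hC, hfin⟩
  obtain ⟨R, hR⟩ := bddAbove_of_isPetite h hC
  have ht : Tendsto (fun x => (ENNReal.ofReal (tailSup γ x))⁻¹) atTop (𝓝 ∞) := by
    have := (ENNReal.tendsto_ofReal (tendsto_tailSup hγ01 h)).inv
    simpa using this
  refine hfin.not_ge (le_of_tendsto ht ?_)
  filter_upwards [eventually_gt_atTop R] with x hx
  exact (inv_tailSup_le_meanReturnTime hC.1 (fun y hy => hR hy) hx).trans
    (le_iSup (meanReturnTime (kernel γ β hγ hγ01 hβ) C) x)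

/-- A positive lower bound `c` on the tail suprema would bound the integral by `1 / c`. -/
theorem tendsto_zero_of_lintegral_eq_top (hγ01 : ∀ x, 0 < γ x ∧ γ x < 1)
    (hβ : ∫⁻ y, (β y : ℝ≥0∞) ∂lebesgue = 1) {x₁ : ℝ≥0}
    (h : ∫⁻ x in Set.Ioi x₁, (β x : ℝ≥0∞) / ENNReal.ofReal (tailSup γ x) ∂lebesgue = ∞) :
    Tendsto γ atTop (𝓝 0) := by
  refine tendsto_order.2 ⟨fun c hc => Eventually.of_forall fun x => hc.trans (hγ01 x).1,
    fun c hc => ?_⟩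
  obtain ⟨x, hx⟩ : ∃ x, tailSup γ x < c := by
    by_contra! hne
    refine absurd h (ne_of_lt ?_)
    calc _ ≤ ∫⁻ x, (β x : ℝ≥0∞) * (ENNReal.ofReal c)⁻¹ ∂lebesgue := by
          refine (setLIntegral_le_lintegral _ _).trans (lintegral_mono fun x => ?_)
          rw [div_eq_mul_inv]
          gcongr
          exact hne x
      _ = (ENNReal.ofReal c)⁻¹ := by
          rw [lintegral_mul_const' _ _ (by simpa using hc), hβ, one_mul]
      _ < ∞ := by simpa using hc
  filter_upwards [eventually_ge_atTop x] with y hy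
  exact (le_tailSup hγ01 hy).trans_lt hx

theorem not_isErgodicChain (hβm : Measurable β) {x₁ : ℝ≥0}
    (h : ∫⁻ x in Set.Ioi x₁, (β x : ℝ≥0∞) / ENNReal.ofReal (tailSup γ x) ∂lebesgue = ∞)
    (ψ : Measure ℝ≥0) : ¬ IsErgodicChain (kernel γ β hγ hγ01 hβ) ψ := by
  rintro ⟨-, C, hC, hψC, hfin⟩
  obtain ⟨R₀, hR₀⟩ := bddAbove_of_isPetite (tendsto_zero_of_lintegral_eq_top hγ01 hβ h) hC
  obtain ⟨R, hR, hxR⟩ : ∃ R, (∀ y ∈ C, y ≤ R) ∧ x₁ ≤ R :=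
    ⟨max R₀ x₁, fun y hy => (hR₀ hy).trans (le_max_left _ _), le_max_right _ _⟩
  have hVm := measurable_meanReturnTime (kernel γ β hγ hγ01 hβ) hC.1
  have hV := fun x => meanReturnTime_first_step (kernel γ β hγ hγ01 hβ) hC.1 x
  have hinv := fun x hx => inv_tailSup_le_meanReturnTime (hγ := hγ) (hγ01 := hγ01) (hβ := hβ)
    hC.1 hR (x := x) hx
  set P := kernel γ β hγ hγ01 hβ
  set V := meanReturnTime P C
  have hVC : ∀ x ∈ C, V x < ∞ := fun x hx => (le_iSup₂ (f := fun x _ => V x) x hx).trans_lt hfin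
  -- The part of the integral up to `R` is finite, so divergence persists above `C`, where the mean
  -- is at least the inverse tail supremum.
  have hV0 : V 0 = ∞ := by
    have h1 : ∫⁻ x in Set.Ioi R, (β x : ℝ≥0∞) / ENNReal.ofReal (tailSup γ x) ∂lebesgue = ∞ := by
      by_contra hne
      refine absurd h (ne_of_lt ?_)
      rw [← Set.Ioc_union_Ioi_eq_Ioi hxR]
      refine (lintegral_union_le _ _ _).trans_lt (ENNReal.add_lt_top.2 ⟨?_, lt_top_iff_ne_top.2 hne⟩)
      have hs := tailSup_pos hγ01 R
      calc _ ≤ ∫⁻ x in Set.Ioc x₁ R, (β x : ℝ≥0∞) * (ENNReal.ofReal (tailSup γ R))⁻¹ ∂lebesgue := by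
            refine setLIntegral_mono' measurableSet_Ioc fun x hx => ?_
            rw [div_eq_mul_inv]
            gcongr
            exact tailSup_antitone hγ01 hx.2
        _ ≤ ∫⁻ x, (β x : ℝ≥0∞) * (ENNReal.ofReal (tailSup γ R))⁻¹ ∂lebesgue :=
            setLIntegral_le_lintegral _ _
        _ = (ENNReal.ofReal (tailSup γ R))⁻¹ := by
            rw [lintegral_mul_const' _ _ (by simpa using hs), hβ, one_mul]
        _ < ∞ := by simpa using hs
    rw [hV 0, ← top_le_iff, ← h1]
    refine le_trans ?_ le_add_self
    rw [← lintegral_indicator hC.1.compl, lintegral_kernel_zero hβm (hVm.indicator hC.1.compl),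
      ← lintegral_indicator measurableSet_Ioi]
    refine lintegral_mono fun x => ?_
    by_cases hx : R < x
    · rw [Set.indicator_of_mem (s := Set.Ioi R) hx,
        Set.indicator_of_mem (s := Cᶜ) fun hmem => (hR x hmem).not_gt hx, div_eq_mul_inv]
      gcongr
      exact hinv x hx
    · rw [Set.indicator_of_notMem (s := Set.Ioi R) hx]
      exact zero_le
  obtain ⟨x, hx⟩ : C.Nonempty := nonempty_of_measure_ne_zero hψC.ne'
  have h0C : (0 : ℝ≥0) ∉ C := fun h0 => (hVC 0 h0).ne hV0
  have hx0 : x ≠ 0 := fun h0 => h0C (h0 ▸ hx)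
  -- From `x` the chain falls to `0`, which lies outside `C`, with positive probability, and the
  -- mean from `0` is infinite.
  refine (hVC x hx).ne ?_
  rw [hV x, ← lintegral_indicator hC.1.compl, lintegral_kernel_of_ne_zero hx0,
    Set.indicator_of_mem (s := Cᶜ) h0C, hV0, ENNReal.mul_top (by simpa using (hγ01 x).1)]
  simp

theorem geomMoment_eq_top (h : Tendsto γ atTop (𝓝 0)) {C : Set ℝ≥0} (hC : MeasurableSet C)
    {r : ℝ≥0} (hr : 1 < r) {x : ℝ≥0} (hx : x ≠ 0) (hxC : ∀ i : ℕ, x + (i + 1 : ℕ) ∉ C) :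
    geomMoment (kernel γ β hγ hγ01 hβ) r C x = ∞ := by
  have hr0 : (0 : ℝ) < r := by exact_mod_cast zero_lt_one.trans hr
  have key : ∀ n : ℕ, ∀ y : ℝ≥0, y ≠ 0 → (∀ i : ℕ, y + (i + 1 : ℕ) ∉ C) →
      ENNReal.ofReal (r ^ n * climb γ n y) ≤ geomMoment (kernel γ β hγ hγ01 hβ) r C y := by
    intro n
    induction n with
    | zero => intro y _ _; simpa [climb] using one_le_geomMoment _ hr.le C y
    | succ n ih =>
      intro y hy hyC
      refine le_trans ?_ (le_geomMoment _ hC hr.le y)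
      have hy1 : y + 1 ∉ C := by simpa using hyC 0
      rw [← lintegral_indicator hC.compl, lintegral_kernel_of_ne_zero hy,
        Set.indicator_of_mem (s := Cᶜ) (a := y + 1) hy1]
      have e : (r : ℝ) ^ (n + 1) * climb γ (n + 1) y =
          r * ((1 - γ y) * (r ^ n * climb γ n (y + 1))) := by
        rw [climb_succ]; ring
      rw [e, ENNReal.ofReal_mul hr0.le, ENNReal.ofReal_mul (sub_pos.2 (hγ01 y).2).le,
        ENNReal.ofReal_coe_nnreal]
      gcongr
      refine le_trans ?_ le_add_self
      gcongr
      refine ih _ (by positivity) fun i hi => hyC (i + 1) ?_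
      convert hi using 1
      push_cast
      ring
  -- Eventually `1 - γ` exceeds `ρ / r`, so `r ^ n` times the climbing probability still grows like
  -- `ρ ^ n`.
  obtain ⟨ρ, hρ1, hρr⟩ : ∃ ρ : ℝ, 1 < ρ ∧ ρ < r := exists_between (by exact_mod_cast hr)
  have hρ : 0 < 1 - ρ / r := sub_pos.2 ((div_lt_one hr0).2 hρr)
  obtain ⟨b, hb⟩ := eventually_atTop.1 (h.eventually_lt_const hρ)
  obtain ⟨m, hm⟩ := exists_nat_ge b
  set c : ℝ := r ^ m * climb γ m x with hc
  have hcpos : 0 < c := mul_pos (pow_pos hr0 m) (climb_pos hγ01 m x)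
  have hlow : ∀ n : ℕ, c * ρ ^ n ≤ r ^ (m + n) * climb γ (m + n) x := by
    intro n
    have h1 : (ρ / r) ^ n ≤ climb γ n (x + m) := by
      rw [← Finset.card_range n, ← Finset.prod_const, Finset.card_range]
      refine Finset.prod_le_prod (fun j _ => by positivity) fun j _ => ?_
      have := hb (x + m + j) (hm.trans (le_add_right le_add_self))
      linarith
    rw [climb_add, pow_add]
    calc c * ρ ^ n = c * (r ^ n * (ρ / r) ^ n) := by
          rw [← mul_pow, mul_div_cancel₀ _ hr0.ne']
      _ ≤ c * (r ^ n * climb γ n (x + m)) := by gcongr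
      _ = _ := by rw [hc]; ring
  have ht : Tendsto (fun n : ℕ => ENNReal.ofReal (c * ρ ^ n)) atTop (𝓝 ∞) :=
    ENNReal.tendsto_ofReal_atTop.comp
      ((tendsto_pow_atTop_atTop_of_one_lt hρ1).const_mul_atTop hcpos)
  refine top_le_iff.1 (le_of_tendsto' ht fun n => ?_)
  exact (ENNReal.ofReal_le_ofReal (hlow n)).trans (key (m + n) x hx hxC)

theorem not_isGeometricallyErgodic (h : Tendsto γ atTop (𝓝 0)) :
    ¬ IsGeometricallyErgodic (kernel γ β hγ hγ01 hβ) := by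
  rintro ⟨C, hC, hne, r, hr, hfin⟩
  obtain ⟨R, hR⟩ := bddAbove_of_isPetite h hC
  have htop := fun x hx hxC => geomMoment_eq_top (hγ := hγ) (hγ01 := hγ01) (hβ := hβ) h hC.1 hr
    (x := x) hx hxC
  have hle := le_geomMoment (kernel γ β hγ hγ01 hβ) hC.1 hr.le 0
  have hC0 : ∀ x ∈ C, geomMoment (kernel γ β hγ hγ01 hβ) r C x < ∞ := fun x hx =>
    (le_iSup₂ (f := fun x _ => geomMoment (kernel γ β hγ hγ01 hβ) r C x) x hx).trans_lt hfin
  by_cases hpos : ∃ x ∈ C, x ≠ 0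
  · classical
    obtain ⟨x, hx, hx0⟩ := hpos
    have hex : ∃ j : ℕ, ∀ i : ℕ, j ≤ i → x + i ∉ C := by
      obtain ⟨j, hj⟩ := exists_nat_gt R
      refine ⟨j, fun i hi hmem => ?_⟩
      have h1 : (j : ℝ≥0) ≤ i := by exact_mod_cast hi
      exact ((hR hmem).trans_lt hj).not_ge (h1.trans le_add_self)
    -- Here `x + j` is the last point of `C` on the ladder above `x`; climbing from it never meets
    -- `C` again.
    obtain ⟨j, hj⟩ : ∃ j, Nat.find hex = j + 1 := by
      refine Nat.exists_eq_succ_of_ne_zero fun h0 => ?_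
      have := Nat.find_spec hex 0 h0.le
      simp at this
      exact this hx
    have hspec := Nat.find_spec hex
    have hmin := Nat.find_min hex (m := j) (by omega)
    push Not at hmin
    obtain ⟨i, hji, hi⟩ := hmin
    have hij : i = j := by
      by_contra hne
      exact hspec i (by omega) hi
    subst hij
    refine (hC0 _ hi).ne (htop _ (fun h0 => hx0 (add_eq_zero.1 h0).1) fun k hk => ?_)
    refine hspec (i + (k + 1)) (by omega) ?_
    convert hk using 1
    push_cast
    ring
  · push Not at hpos
    have h0 : (0 : ℝ≥0) ∈ C := by
      obtain ⟨x, hx⟩ := hne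
      rwa [hpos x hx] at hx
    -- Now `C` is `{0}`, and the first jump leads almost surely to a point with infinite moment.
    refine (hC0 0 h0).ne (top_le_iff.1 (le_trans ?_ hle))
    have h1 : ∫⁻ _, (∞ : ℝ≥0∞) ∂(kernel γ β hγ hγ01 hβ 0) ≤
        ∫⁻ y in Cᶜ, geomMoment (kernel γ β hγ hγ01 hβ) r C y ∂(kernel γ β hγ hγ01 hβ 0) := by
      rw [← lintegral_indicator hC.1.compl]
      refine lintegral_kernel_zero_le fun y hy => ?_
      rw [Set.indicator_of_mem (s := Cᶜ) fun hmem => hy (hpos y hmem),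
        htop y hy fun i hi => (by positivity : y + (i + 1 : ℕ) ≠ 0) (hpos _ hi)]
    rw [lintegral_const, measure_univ, mul_one, top_le_iff] at h1
    rw [h1, ENNReal.mul_top (by simpa using (zero_lt_one.trans hr).ne')]

end JumpChain

/-! ### Petiteness of singletons -/

namespace MarkovChain

theorem isPetite_singleton {X : Type*} [MeasurableSpace X] [MeasurableSingletonClass X]
    (P : Kernel X X) [IsMarkovKernel P] (a : X) : IsPetite P {a} := by
  refine ⟨measurableSet_singleton a, PMF.pure 1, P a, IsProbabilityMeasure.ne_zero _, ?_⟩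
  rintro x rfl B -
  refine le_trans ?_ (ENNReal.le_tsum 1)
  simp

end MarkovChain

namespace JumpChain

open MarkovChain

/-! ### Return times to `0` -/

variable {γ : ℝ≥0 → ℝ} {β : ℝ≥0 → ℝ≥0} {hγ : Continuous γ} {hγ01 : ∀ x, 0 < γ x ∧ γ x < 1}
  {hβ : ∫⁻ y, (β y : ℝ≥0∞) ∂lebesgue = 1}

theorem setLIntegral_kernel_of_ne_zero {x : ℝ≥0} (hx : x ≠ 0) (f : ℝ≥0 → ℝ≥0∞) :
    ∫⁻ y in {0}ᶜ, f y ∂(kernel γ β hγ hγ01 hβ x) = ENNReal.ofReal (1 - γ x) * f (x + 1) := by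
  rw [← lintegral_indicator (measurableSet_singleton 0).compl, lintegral_kernel_of_ne_zero hx]
  simp

theorem meanReturnTime_zero_of_ne_zero {x : ℝ≥0} (hx : x ≠ 0) :
    meanReturnTime (kernel γ β hγ hγ01 hβ) {0} x =
      1 + ENNReal.ofReal (1 - γ x) * meanReturnTime (kernel γ β hγ hγ01 hβ) {0} (x + 1) := by
  rw [meanReturnTime_first_step _ (measurableSet_singleton 0), setLIntegral_kernel_of_ne_zero hx]

theorem meanReturnTime_zero_le_of_drift {f : ℝ≥0 → ℝ≥0∞}
    (hf : ∀ x ≠ 0, 1 + ENNReal.ofReal (1 - γ x) * f (x + 1) ≤ f x) {x : ℝ≥0} (hx : x ≠ 0) :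
    meanReturnTime (kernel γ β hγ hγ01 hβ) {0} x ≤ f x := by
  refine meanReturnTime_le_of_drift _ (measurableSet_singleton 0) (fun y hy => ?_) hx
  rw [setLIntegral_kernel_of_ne_zero hy]
  exact hf y hy

/-- A fall during the first `n` steps only shortens the time, so bounds at high levels carry down to
low ones. -/
theorem meanReturnTime_zero_le_add (n : ℕ) {x : ℝ≥0} (hx : x ≠ 0) :
    meanReturnTime (kernel γ β hγ hγ01 hβ) {0} x ≤
      n + meanReturnTime (kernel γ β hγ hγ01 hβ) {0} (x + n) := by
  induction n generalizing x with
  | zero => simp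
  | succ n ih =>
    rw [meanReturnTime_zero_of_ne_zero hx]
    calc _ ≤ 1 + 1 * (n + meanReturnTime (kernel γ β hγ hγ01 hβ) {0} (x + 1 + n)) := by
          gcongr
          · exact ENNReal.ofReal_le_one.2 (by linarith [(hγ01 x).1])
          · exact ih (by positivity)
      _ = _ := by
          rw [one_mul, ← add_assoc]
          push_cast
          rw [add_comm (1 : ℝ≥0∞), add_assoc x 1, add_comm (1 : ℝ≥0)]

theorem natCast_mul_climb_le_meanReturnTime (n : ℕ) {x : ℝ≥0} (hx : x ≠ 0) :
    n * ENNReal.ofReal (climb γ n x) ≤ meanReturnTime (kernel γ β hγ hγ01 hβ) {0} x := by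
  induction n generalizing x with
  | zero => simp
  | succ n ih =>
    rw [meanReturnTime_zero_of_ne_zero hx]
    have h1 : ENNReal.ofReal (climb γ (n + 1) x) ≤ 1 := by
      refine ENNReal.ofReal_le_one.2 ((climb_antitone hγ01 x (Nat.zero_le (n + 1))).trans ?_)
      simp [climb]
    calc ((n + 1 : ℕ) : ℝ≥0∞) * ENNReal.ofReal (climb γ (n + 1) x)
        = ENNReal.ofReal (climb γ (n + 1) x) +
          ENNReal.ofReal (1 - γ x) * (n * ENNReal.ofReal (climb γ n (x + 1))) := by
          push_cast
          rw [add_mul, one_mul, add_comm, mul_left_comm, ← ofReal_climb_succ hγ01]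
      _ ≤ _ := by
          gcongr
          exact ih (by positivity)

/-- Markov's inequality: the climbing probability is at most the mean divided by `n`. Harris
recurrence thus follows from finite means. -/
theorem tendsto_climb_of_meanReturnTime_lt_top {x : ℝ≥0} (hx : x ≠ 0)
    (h : meanReturnTime (kernel γ β hγ hγ01 hβ) {0} x < ∞) :
    Tendsto (fun n => climb γ n x) atTop (𝓝 0) := by
  set V := meanReturnTime (kernel γ β hγ hγ01 hβ) {0} x with hV
  refine squeeze_zero' (Eventually.of_forall fun n => (climb_pos hγ01 n x).le) ?_
    (tendsto_const_div_atTop_nhds_zero_nat V.toReal)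
  filter_upwards [eventually_gt_atTop 0] with n hn
  have h1 := ENNReal.toReal_mono h.ne (natCast_mul_climb_le_meanReturnTime (hγ := hγ)
    (hγ01 := hγ01) (hβ := hβ) n hx)
  rw [ENNReal.toReal_mul, ENNReal.toReal_natCast,
    ENNReal.toReal_ofReal (climb_pos hγ01 n x).le] at h1
  rw [le_div_iff₀ (by exact_mod_cast hn), mul_comm]
  exact h1

theorem exists_pos_le_on_Icc (hγ : Continuous γ) (hγ01 : ∀ x, 0 < γ x ∧ γ x < 1) (R : ℝ≥0) :
    ∃ δ : ℝ, 0 < δ ∧ ∀ x ≤ R, δ ≤ γ x := by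
  obtain ⟨z, -, hz⟩ := (isCompact_Icc (a := (0 : ℝ≥0)) (b := R)).exists_isMinOn
    ⟨0, le_rfl, zero_le⟩ hγ.continuousOn
  exact ⟨γ z, (hγ01 z).1, fun x hx => hz ⟨zero_le, hx⟩⟩

/-- The Lyapunov function is `c / γ`. One step up adds at most `c * η` to it and a fall saves `c` on
average, so `c * (1 - η) = 1` pays for the unit of time. -/
theorem meanReturnTime_zero_le_div {x₁ : ℝ≥0} {η : ℝ} (hη0 : 0 ≤ η) (hη1 : η < 1)
    (h : ∀ x, x₁ < x → 1 / γ (x + 1) - 1 / γ x ≤ η) {x : ℝ≥0} (hx : x₁ < x) :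
    meanReturnTime (kernel γ β hγ hγ01 hβ) {0} x ≤ ENNReal.ofReal ((1 - η)⁻¹ / γ x) := by
  classical
  have hc : 0 < (1 - η)⁻¹ := inv_pos.2 (sub_pos.2 hη1)
  set c := (1 - η)⁻¹ with hcdef
  have hc1 : c - c * η = 1 := by
    rw [hcdef, ← mul_one_sub, inv_mul_cancel₀ (sub_pos.2 hη1).ne']
  have key := meanReturnTime_zero_le_of_drift (γ := γ) (β := β) (hγ := hγ) (hγ01 := hγ01)
    -- The value `∞` up to `x₁` makes the drift condition trivial there and is harmless, since the
    -- climb never comes back below.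
    (hβ := hβ) (f := fun y => if x₁ < y then ENNReal.ofReal (c / γ y) else ∞) (fun y hy => ?_)
    (zero_le.trans_lt hx).ne'
  · simpa [hx] using key
  · by_cases hy1 : x₁ < y
    · have hy2 : x₁ < y + 1 := hy1.trans_le (le_add_of_nonneg_right zero_le_one)
      have hγy := hγ01 y
      have hγy1 := hγ01 (y + 1)
      have hq : 0 ≤ 1 - γ y := (sub_pos.2 hγy.2).le
      simp only [hy1, hy2, if_true]
      rw [← ENNReal.ofReal_mul hq, ← ENNReal.ofReal_one,
        ← ENNReal.ofReal_add zero_le_one (mul_nonneg hq (div_pos hc hγy1.1).le)]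
      refine ENNReal.ofReal_le_ofReal ?_
      have h1 : c / γ (y + 1) ≤ c / γ y + c * η := by
        have := mul_le_mul_of_nonneg_left (h y hy1) hc.le
        rw [mul_sub, mul_one_div, mul_one_div] at this
        linarith
      have h2 : γ y * (c / γ y) = c := mul_div_cancel₀ _ hγy.1.ne'
      have h3 := mul_le_mul_of_nonneg_left h1 hq
      have h4 : 0 ≤ γ y * (c * η) := mul_nonneg hγy.1.le (mul_nonneg hc.le hη0)
      nlinarith
    · simp [hy1]

theorem isErgodicChain_of_drift (hβm : Measurable β) {x₁ : ℝ≥0} {η : ℝ} (hη0 : 0 ≤ η) (hη1 : η < 1)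
    (h : ∀ x, x₁ < x → 1 / γ (x + 1) - 1 / γ x ≤ η)
    (hint : ∫⁻ y in Set.Ioi x₁, (β y : ℝ≥0∞) / ENNReal.ofReal (γ y) ∂lebesgue < ∞)
    {ψ : Measure ℝ≥0} (hψ : IsMaximalIrreducibilityMeasure (kernel γ β hγ hγ01 hβ) ψ) :
    IsErgodicChain (kernel γ β hγ hγ01 hβ) ψ := by
  have hψ0 := hψ.singleton_pos _ 0 zero_accessible
  have hlarge := fun x (hx : x₁ < x) => meanReturnTime_zero_le_div (β := β) (hγ := hγ)
    (hγ01 := hγ01) (hβ := hβ) hη0 hη1 h hx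
  have hadd := fun n x (hx : x ≠ 0) => meanReturnTime_zero_le_add (β := β) (hγ := hγ)
    (hγ01 := hγ01) (hβ := hβ) n hx
  have hVm := measurable_meanReturnTime (kernel γ β hγ hγ01 hβ) (measurableSet_singleton 0)
  have hc : 0 < (1 - η)⁻¹ := inv_pos.2 (sub_pos.2 hη1)
  set c := (1 - η)⁻¹
  obtain ⟨n, hn⟩ := exists_nat_gt x₁
  obtain ⟨δ, hδ, hδle⟩ := exists_pos_le_on_Icc hγ hγ01 (x₁ + n)
  -- From below `x₁`, `n` upward steps pass `x₁` and stay where `γ ≥ δ` by compactness.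
  set K : ℝ≥0∞ := n + ENNReal.ofReal (c / δ) with hK
  have hKfin : K < ∞ := by simp [hK]
  have hsmall : ∀ x ≠ 0, x ≤ x₁ → meanReturnTime (kernel γ β hγ hγ01 hβ) {0} x ≤ K := by
    intro x hx hxle
    refine (hadd n x hx).trans ?_
    rw [hK]
    gcongr
    refine (hlarge _ (hn.trans_le le_add_self)).trans (ENNReal.ofReal_le_ofReal ?_)
    have := hδle (x + n) (by gcongr)
    gcongr
  have hfin : ∀ x ≠ 0, meanReturnTime (kernel γ β hγ hγ01 hβ) {0} x < ∞ := fun x hx => by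
    rcases le_or_gt x x₁ with hle | hlt
    · exact (hsmall x hx hle).trans_lt hKfin
    · exact (hlarge x hlt).trans_lt ENNReal.ofReal_lt_top
  refine ⟨isHarrisRecurrent_of_tendsto_climb
    (fun x hx => tendsto_climb_of_meanReturnTime_lt_top hx (hfin x hx)) hψ.irreducible,
    {0}, isPetite_singleton _ 0, hψ0, ?_⟩
  simp only [Set.mem_singleton_iff, iSup_iSup_eq_left]
  rw [meanReturnTime_first_step _ (measurableSet_singleton 0)]
  refine ENNReal.add_lt_top.2 ⟨ENNReal.one_lt_top, (setLIntegral_le_lintegral _ _).trans_lt ?_⟩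
  let f : ℝ≥0 → ℝ≥0∞ := fun y =>
    K + (Set.Ioi x₁).indicator (fun y => ENNReal.ofReal (c / γ y)) y
  have hindm : Measurable ((Set.Ioi x₁).indicator fun y => ENNReal.ofReal (c / γ y)) :=
    (measurable_const.div hγ.measurable).ennreal_ofReal.indicator measurableSet_Ioi
  have hle : ∀ y ≠ 0, meanReturnTime (kernel γ β hγ hγ01 hβ) {0} y ≤ f y := fun y hy => by
    rcases le_or_gt y x₁ with hle | hlt
    · exact (hsmall y hy hle).trans le_self_add
    · refine (hlarge y hlt).trans ?_
      simp only [f, Set.indicator_of_mem (s := Set.Ioi x₁) hlt]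
      exact le_add_self
  refine (lintegral_kernel_zero_le hle).trans_lt ?_
  simp only [f]
  rw [lintegral_add_left measurable_const, lintegral_kernel_zero hβm hindm]
  refine ENNReal.add_lt_top.2 ⟨by simpa using hKfin, ?_⟩
  have e : ∫⁻ y, (β y : ℝ≥0∞) * (Set.Ioi x₁).indicator (fun y => ENNReal.ofReal (c / γ y)) y
      ∂lebesgue = ENNReal.ofReal c *
        ∫⁻ y in Set.Ioi x₁, (β y : ℝ≥0∞) / ENNReal.ofReal (γ y) ∂lebesgue := by
    rw [← lintegral_const_mul' _ _ ENNReal.ofReal_ne_top, ← lintegral_indicator measurableSet_Ioi]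
    refine lintegral_congr fun y => ?_
    by_cases hy : x₁ < y
    · rw [Set.indicator_of_mem (s := Set.Ioi x₁) hy, Set.indicator_of_mem (s := Set.Ioi x₁) hy,
        ENNReal.ofReal_div_of_pos (hγ01 y).1, div_eq_mul_inv, div_eq_mul_inv, mul_left_comm]
    · rw [Set.indicator_of_notMem (s := Set.Ioi x₁) hy, Set.indicator_of_notMem (s := Set.Ioi x₁) hy,
        mul_zero]
  rw [e]
  exact ENNReal.mul_lt_top ENNReal.ofReal_lt_top hint

theorem isStronglyErgodic_of_le {c : ℝ} (hc : 0 < c) (h : ∀ x, c ≤ γ x) :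
    IsStronglyErgodic (kernel γ β hγ hγ01 hβ) := by
  -- The constant `1 / c`, the mean of a geometric time of parameter `c`, is a supersolution.
  have hV : ∀ x ≠ 0, meanReturnTime (kernel γ β hγ hγ01 hβ) {0} x ≤ ENNReal.ofReal c⁻¹ :=
    fun x hx => meanReturnTime_zero_le_of_drift (f := fun _ => ENNReal.ofReal c⁻¹)
      (fun y _ => by
        have hq : 0 ≤ 1 - γ y := (sub_pos.2 (hγ01 y).2).le
        rw [← ENNReal.ofReal_mul hq, ← ENNReal.ofReal_one,
          ← ENNReal.ofReal_add zero_le_one (mul_nonneg hq (inv_pos.2 hc).le)]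
        refine ENNReal.ofReal_le_ofReal ?_
        have h1 := mul_le_mul_of_nonneg_right (h y) (inv_pos.2 hc).le
        rw [mul_inv_cancel₀ hc.ne'] at h1
        linarith) hx
  refine ⟨{0}, isPetite_singleton _ 0, ?_⟩
  refine lt_of_le_of_lt (iSup_le fun x => ?_)
    (ENNReal.add_lt_top.2 ⟨ENNReal.one_lt_top, ENNReal.ofReal_lt_top (r := c⁻¹)⟩)
  by_cases hx : x = 0
  · subst hx
    rw [meanReturnTime_first_step _ (measurableSet_singleton 0)]
    gcongr
    refine (setLIntegral_le_lintegral _ _).trans ((lintegral_kernel_zero_le hV).trans ?_)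
    simp
  · exact (hV x hx).trans le_add_self

theorem tendsto_zero_of_limsup_eq_zero (hγ01 : ∀ x, 0 < γ x ∧ γ x < 1)
    (h : limsup γ atTop = 0) : Tendsto γ atTop (𝓝 0) := by
  refine tendsto_order.2 ⟨fun c hc => Eventually.of_forall fun x => hc.trans (hγ01 x).1,
    fun c hc => ?_⟩
  exact eventually_lt_of_limsup_lt (h ▸ hc) (isBoundedUnder_of ⟨1, fun x => (hγ01 x).2.le⟩)

theorem exists_pos_le_of_liminf_pos (hγ : Continuous γ) (hγ01 : ∀ x, 0 < γ x ∧ γ x < 1)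
    (h : 0 < liminf γ atTop) : ∃ c : ℝ, 0 < c ∧ ∀ x, c ≤ γ x := by
  obtain ⟨c, hc, hlt⟩ := exists_between h
  have hev := eventually_lt_of_lt_liminf hlt (isBoundedUnder_of ⟨0, fun x => (hγ01 x).1.le⟩)
  obtain ⟨R, hR⟩ := eventually_atTop.1 hev
  obtain ⟨δ, hδ, hδle⟩ := exists_pos_le_on_Icc hγ hγ01 R
  refine ⟨min c δ, lt_min hc hδ, fun x => ?_⟩
  rcases le_total x R with hx | hx
  · exact (min_le_right _ _).trans (hδle x hx)
  · exact (min_le_left _ _).trans (hR x hx).le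

end JumpChain

end

open MarkovChain JumpChain in
theorem proposition2 (γ : ℝ≥0 → ℝ) (β : ℝ≥0 → ℝ≥0)
    (hγ : Continuous γ) (hγ01 : ∀ x, 0 < γ x ∧ γ x < 1)
    (hβm : Measurable β) (hβ : ∫⁻ y, (β y : ℝ≥0∞) ∂lebesgue = 1) :
    let P : Kernel ℝ≥0 ℝ≥0 := kernel γ β hγ hγ01 hβ
    -- the chain is irreducible, with some maximal irreducibility measure
    (∃ ψ : Measure ℝ≥0, IsMaximalIrreducibilityMeasure P ψ) ∧
    ∀ ψ : Measure ℝ≥0, IsMaximalIrreducibilityMeasure P ψ →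
      -- (1) recurrence
      ((∃ x₁ : ℝ≥0, 0 < x₁ ∧
          Tendsto (fun N : ℕ => ∏ k ∈ Finset.Ico ⌊x₁⌋₊ N,
            sSup ((fun x : ℝ≥0 => 1 - γ x) '' Set.Ico (k : ℝ≥0) (k + 1))) atTop (𝓝 0)) →
        IsHarrisRecurrent P ψ ∧ IsRecurrent P ψ) ∧
      -- (1) transience
      ((∃ x₁ : ℝ≥0, 0 < x₁ ∧ ∃ p : ℝ, 0 < p ∧
          Tendsto (fun N : ℕ => ∏ k ∈ Finset.Ico ⌊x₁⌋₊ N,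
            sInf ((fun x : ℝ≥0 => 1 - γ x) '' Set.Ico (k : ℝ≥0) (k + 1))) atTop (𝓝 p)) →
        IsTransient P ψ) ∧
      -- (2) non-ergodicity
      ((∃ x₁ : ℝ≥0, 0 < x₁ ∧
          ∫⁻ x in Set.Ioi x₁, (β x : ℝ≥0∞) / ENNReal.ofReal (sSup (γ '' Set.Ici x)) ∂lebesgue
            = ∞) →
        ¬ IsErgodicChain P ψ) ∧
      -- (2) ergodicity
      ((∃ x₁ : ℝ≥0, 0 < x₁ ∧
          (⨆ x : Set.Ioi x₁, ((1 / γ (x + 1) - 1 / γ x : ℝ) : EReal)) < 1 ∧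
          ∫⁻ y in Set.Ioi x₁, (β y : ℝ≥0∞) / ENNReal.ofReal (γ y) ∂lebesgue < ∞) →
        IsErgodicChain P ψ) ∧
      -- (3) neither geometrically nor strongly ergodic
      (limsup γ atTop = 0 → ¬ IsGeometricallyErgodic P ∧ ¬ IsStronglyErgodic P) ∧
      -- (4) strong ergodicity
      (0 < liminf γ atTop → IsStronglyErgodic P) := by
  intro P
  refine ⟨exists_isMaximalIrreducibilityMeasure P 0 zero_accessible, fun ψ hψ =>
    ⟨?_, ?_, ?_, ?_, fun h => ?_, fun h => ?_⟩⟩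
  · rintro ⟨x₁, -, h⟩
    have hH : IsHarrisRecurrent P ψ := isHarrisRecurrent_of_tendsto_climb
      (fun x _ => tendsto_climb_of_tendsto_prod_sSup hγ01 h x) hψ.irreducible
    exact ⟨hH, hH.isRecurrent⟩
  · rintro ⟨x₁, -, p, hp, h⟩
    exact isTransient_of_le_climb (exists_pos_le_climb_of_tendsto_prod_sInf hγ01 hp h) hψ
  · rintro ⟨x₁, -, h⟩
    exact not_isErgodicChain hβm h ψ
  · rintro ⟨x₁, -, hsup, hint⟩
    -- A real number strictly between the supremum and `1`; it may be negative, hence `max q 0` as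
    -- the drift constant.
    obtain ⟨q, hq, hq1⟩ := EReal.lt_iff_exists_real_btwn.1 hsup
    refine isErgodicChain_of_drift hβm (le_max_right q 0)
      (max_lt (by exact_mod_cast hq1) zero_lt_one) (fun x hx => ?_) hint hψ
    have h1 := (le_iSup (fun x : Set.Ioi x₁ => ((1 / γ (x + 1) - 1 / γ x : ℝ) : EReal))
      ⟨x, hx⟩).trans hq.le
    exact (EReal.coe_le_coe_iff.1 h1).trans (le_max_left q 0)
  · have h0 := tendsto_zero_of_limsup_eq_zero hγ01 h
    exact ⟨not_isGeometricallyErgodic h0, not_isStronglyErgodic h0⟩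
  · obtain ⟨c, hc, hle⟩ := exists_pos_le_of_liminf_pos hγ hγ01 h
    exact isStronglyErgodic_of_le hc hle
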